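/- Let $p$ be a prime and let $G=(V,E)$ be a finite connected simple (undirected) graph with a symmetric weight function $\kappa\colon V\times V\to[0,1]$ such that $\kappa(v,w)=0$ if and only if $\{v,w\}\notin E$. Let $d_E(v,w)$ be the weighted shortest-path distance (the infimum over all walks from $v$ to $w$ of the sum of the weights $\kappa$ of their edges), and let $\delta$ be the subdominant ultrametric of $d_E$, that is, the largest ultrametric on $V$ with $\delta\le d_E$. Let $\alpha\ge 1$ be real, let $\bullet\in\{\kappa,d_E,\delta\}$, and for $v\ne w$ in $V$ put $$k(v,w)=\begin{cases}\kappa(v,w)^{-\alpha}\ \text{if }\{v,w\}\in E,\quad 0\ \text{otherwise},&\bullet=\kappa,\\ d_E(v,w)^{-\alpha},&\bullet=d_E,\\ \delta(v,w)^{-\alpha},&\bullet=\delta.\end{cases}$$ Let the vertices $v\in V$ be represented by pairwise disjoint discs $U_v=\{x\in\mathbb Z_p: |x-c_v|_p\le p^{-m_v}\}$ with $c_v\in\mathbb Z_p$ and $m_v\in\mathbb N$, let $Z=\bigsqcup_{v\in V}U_v\subseteq\mathbb Z_p$, and for $x\in Z$ let $v(x)$ be the vertex with $x\in U_{v(x)}$.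 For $x, y\in Z$ with $x\neq y$ put $$k_\bullet(x,y)=\begin{cases}|x-y|_p^{-\alpha},&v(x)=v(y),\\ k(v(x),v(y)),&v(x)\ne v(y).\end{cases}$$ Let $dy$ be the Haar measure with $\mathbb Z_p$ of mass $1$, and let $C(Z,\mathbb R)$ carry the sup norm. Let $\mathcal H_\bullet$ be the operator on $C(Z,\mathbb R)$ $$\mathcal H_\bullet u(x)=\int_Z k_\bullet(x,y)\,(u(y)-u(x))\,dy ,$$ whose domain consists of all $u\in C(Z,\mathbb R)$ for which this integral converges absolutely for every $x\in Z$ and defines a continuous function of $x$. Then $\mathcal H_\bullet$ is closable, and its closure $\overline{\mathcal H_\bullet}$ is the infinitesimal generator of exactly one Feller semigroup $\exp(t\mathcal H_\bullet)$, $t\ge0$, on $C(Z,\mathbb R)$ (a strongly continuous one-parameter semigroup of positive contractions). Moreover, $\overline{\mathcal H_\bullet}$ is the operator given by the same integral read as an improper integral, on its natural domain: for $u,g\in C(Z,\mathbb R)$, $u$ lies in the domain of $\overline{\mathcal H_\bullet}$ and $\overline{\mathcal H_\bullet}u=g$ if and only if, for every $x\in Z$, $$\lim_{\varepsilon\to0+}\int_{\{y\in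 Z:\ |x-y|_p>\varepsilon\}}k_\bullet(x,y)\,(u(y)-u(x))\,dy=g(x).$$ -/

import Mathlib

open MeasureTheory Filter Topology
open scoped NNReal

namespace PadicGraph

noncomputable section

/-! ### Feller semigroups and their infinitesimal generators -/

/-- A Feller semigroup on `C(X, ℝ)` (sup norm), for a compact space `X`: a strongly continuous
one-parameter semigroup of positive contractions. -/
structure IsFellerSemigroup {X : Type*} [TopologicalSpace X] [CompactSpace X]
    (T : ℝ≥0 → C(X, ℝ) →L[ℝ] C(X, ℝ)) : Prop where
  map_zero : T 0 = ContinuousLinearMap.id ℝ C(X, ℝ)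
  map_add : ∀ s t : ℝ≥0, T (s + t) = (T s).comp (T t)
  strongly_continuous : ∀ f : C(X, ℝ), Continuous fun t => T t f
  positive : ∀ (t : ℝ≥0) (f : C(X, ℝ)), 0 ≤ f → 0 ≤ T t f
  contraction : ∀ (t : ℝ≥0) (f : C(X, ℝ)), ‖T t f‖ ≤ ‖f‖

/-- `(f, g)` is in the graph of the generator iff `(T t f - f) / t → g` in norm as `t → 0+`. -/
def IsGeneratorPair {E : Type*} [NormedAddCommGroup E] [NormedSpace ℝ E]
    (T : ℝ≥0 → E →L[ℝ] E) (f g : E) : Prop :=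
  Tendsto (fun t : ℝ≥0 => (t : ℝ)⁻¹ • (T t f - f)) (𝓝[>] 0) (𝓝 g)

theorem IsGeneratorPair.unique {E : Type*} [NormedAddCommGroup E] [NormedSpace ℝ E]
    {T : ℝ≥0 → E →L[ℝ] E} {f g g' : E} (h : IsGeneratorPair T f g)
    (h' : IsGeneratorPair T f g') : g = g' :=
  tendsto_nhds_unique h h'

theorem IsGeneratorPair.add {E : Type*} [NormedAddCommGroup E] [NormedSpace ℝ E]
    {T : ℝ≥0 → E →L[ℝ] E} {f g f' g' : E} (h : IsGeneratorPair T f g)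
    (h' : IsGeneratorPair T f' g') : IsGeneratorPair T (f + f') (g + g') := by
  refine (Tendsto.add h h').congr fun t => ?_
  rw [map_add, ← smul_add]
  congr 1
  abel

theorem IsGeneratorPair.smul {E : Type*} [NormedAddCommGroup E] [NormedSpace ℝ E]
    {T : ℝ≥0 → E →L[ℝ] E} {f g : E} (c : ℝ) (h : IsGeneratorPair T f g) :
    IsGeneratorPair T (c • f) (c • g) := by
  refine (Tendsto.const_smul h c).congr fun t => ?_
  rw [map_smul, ← smul_sub, smul_comm]

/-- The infinitesimal generator of a family `T` of operators: the unbounded operator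
`f ↦ lim_{t → 0+} (T t f - f) / t`, on the subspace of all `f` for which the limit exists. -/
def generator {E : Type*} [NormedAddCommGroup E] [NormedSpace ℝ E]
    (T : ℝ≥0 → E →L[ℝ] E) : E →ₗ.[ℝ] E where
  domain :=
    { carrier := {f | ∃ g, IsGeneratorPair T f g}
      add_mem' := fun ⟨g, hg⟩ ⟨g', hg'⟩ => ⟨g + g', hg.add hg'⟩
      zero_mem' := ⟨0, by simp [IsGeneratorPair]⟩
      smul_mem' := fun c _ ⟨g, hg⟩ => ⟨c • g, hg.smul c⟩ }
  toFun :=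
    { toFun := fun f => f.2.choose
      map_add' := fun f f' =>
        (f + f').2.choose_spec.unique (f.2.choose_spec.add f'.2.choose_spec)
      map_smul' := fun c f => (c • f).2.choose_spec.unique (f.2.choose_spec.smul c) }

/-! ### Weighted graphs and the three kernels on the vertices -/

/-- `κ` is a weight function of the (undirected) graph `G`: symmetric, with values in `[0, 1]`, and
`κ v w = 0` exactly when `v w` is not an edge. -/
structure IsWeight {V : Type*} (G : SimpleGraph V) (κ : V → V → ℝ) : Prop where
  symm : ∀ v w, κ v w = κ w v
  nonneg : ∀ v w, 0 ≤ κ v w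
  le_one : ∀ v w, κ v w ≤ 1
  eq_zero_iff : ∀ v w, κ v w = 0 ↔ ¬ G.Adj v w

/-- The length of a walk: the sum of the weights of its edges. -/
def walkLength {V : Type*} {G : SimpleGraph V} (κ : V → V → ℝ) {v w : V} (q : G.Walk v w) : ℝ :=
  (q.darts.map fun d => κ d.fst d.snd).sum

/-- The weighted shortest-path distance of a (connected) weighted graph. -/
def graphDist {V : Type*} (G : SimpleGraph V) (κ : V → V → ℝ) (v w : V) : ℝ :=
  ⨅ q : G.Walk v w, walkLength κ q

/-- `ρ` is an ultrametric on `V`. -/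
structure IsUltrametric {V : Type*} (ρ : V → V → ℝ) : Prop where
  nonneg : ∀ v w, 0 ≤ ρ v w
  eq_zero_iff : ∀ v w, ρ v w = 0 ↔ v = w
  symm : ∀ v w, ρ v w = ρ w v
  ultra : ∀ u v w, ρ u w ≤ max (ρ u v) (ρ v w)

/-- The subdominant ultrametric of `d`: the largest ultrametric that is pointwise at most `d`. -/
def subdominant {V : Type*} (d : V → V → ℝ) (v w : V) : ℝ :=
  sSup {r | ∃ ρ : V → V → ℝ, IsUltrametric ρ ∧ (∀ a b, ρ a b ≤ d a b) ∧ ρ v w = r}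

/-- The three choices `κ`, `d_E`, `δ` of the index `•`. -/
inductive Bullet
  | kappa
  | dE
  | delta

open Classical in
/-- The kernel `k` on the vertices: the power `-α` of the edge weight `κ` (zero for non-edges), of
the graph distance `d_E`, or of its subdominant ultrametric `δ`. Only its values at pairs of
distinct vertices are ever used. -/
def vertexKernel {V : Type*} (G : SimpleGraph V) (κ : V → V → ℝ) (α : ℝ) :
    Bullet → V → V → ℝ
  | .kappa, v, w => if G.Adj v w then κ v w ^ (-α) else 0
  | .dE, v, w => graphDist G κ v w ^ (-α)
  | .delta, v, w => subdominant (graphDist G κ) v w ^ (-α)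

/-! ### The `p`-adic domain -/

instance instMeasurableSpacePadicInt (p : ℕ) [Fact p.Prime] : MeasurableSpace ℤ_[p] := borel _

instance instBorelSpacePadicInt (p : ℕ) [Fact p.Prime] : BorelSpace ℤ_[p] := ⟨rfl⟩

/-- The Haar measure of `ℤ_[p]` with total mass `1` (the restriction to `ℤ_[p]` of the normalised
Haar measure of `ℚ_[p]`). -/
def haar (p : ℕ) [Fact p.Prime] : Measure ℤ_[p] := Measure.addHaarMeasure ⊤

/-- A representation of the elements of `V` by pairwise disjoint discs of `ℤ_[p]`; the disc of `v`
has centre `center v` and radius `p ^ (-level v)`. -/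
structure VertexDiscs (p : ℕ) [Fact p.Prime] (V : Type*) where
  center : V → ℤ_[p]
  level : V → ℕ
  disjoint : Pairwise fun v w =>
    Disjoint (Metric.closedBall (center v) ((p : ℝ) ^ (-(level v : ℤ))))
      (Metric.closedBall (center w) ((p : ℝ) ^ (-(level w : ℤ))))

namespace VertexDiscs

variable {p : ℕ} [Fact p.Prime] {V : Type*} (D : VertexDiscs p V)

/-- The disc that represents the vertex `v`. -/
def disc (v : V) : Set ℤ_[p] := Metric.closedBall (D.center v) ((p : ℝ) ^ (-(D.level v : ℤ)))

/-- The union `Z` of the discs of all vertices. -/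
def Z : Set ℤ_[p] := ⋃ v, D.disc v

instance [Finite V] : CompactSpace D.Z :=
  isCompact_iff_compactSpace.mp (isCompact_iUnion fun _ => Metric.isClosed_closedBall.isCompact)

/-- The restriction of the Haar measure to `Z`, as a measure on the subspace `Z`. -/
def measure : Measure D.Z := Measure.comap Subtype.val (haar p)

/-- The vertex `v(x)` whose disc contains the point `x` of `Z`. -/
def vertexOf (x : D.Z) : V := (Set.mem_iUnion.mp x.2).choose

theorem mem_disc_vertexOf (x : D.Z) : (x : ℤ_[p]) ∈ D.disc (D.vertexOf x) :=
  (Set.mem_iUnion.mp x.2).choose_spec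

theorem vertexOf_eq_iff (x : D.Z) (v : V) : D.vertexOf x = v ↔ (x : ℤ_[p]) ∈ D.disc v := by
  constructor
  · rintro rfl
    exact D.mem_disc_vertexOf x
  · intro h
    by_contra hne
    exact Set.disjoint_left.mp (D.disjoint hne) (D.mem_disc_vertexOf x) h

open Classical in
/-- The kernel `k_p` on `Z × Z` built from a kernel `k` on the vertices: `|x - y|_p ^ (-α)` inside
a disc, `k (v(x)) (v(y))` between different discs. -/
def padicKernel (α : ℝ) (k : V → V → ℝ) (x y : D.Z) : ℝ :=
  if D.vertexOf x = D.vertexOf y then ‖(x : ℤ_[p]) - y‖ ^ (-α)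
  else k (D.vertexOf x) (D.vertexOf y)

/-- The hierarchical Parisi operator `u ↦ (x ↦ ∫_Z k(x, y) (u(y) - u(x)) dy)` of a kernel `k` on
`Z × Z`, as an unbounded operator on `C(Z, ℝ)`. Its domain consists of all `u` for which the
integral converges absolutely at every `x` in `Z` and is a continuous function of `x`. -/
def parisiOperator (k : D.Z → D.Z → ℝ) : C(D.Z, ℝ) →ₗ.[ℝ] C(D.Z, ℝ) where
  domain :=
    { carrier := {u | (∀ x, Integrable (fun y => k x y * (u y - u x)) D.measure) ∧
        Continuous fun x => ∫ y, k x y * (u y - u x) ∂D.measure}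
      add_mem' := by
        rintro u w ⟨hu, hu'⟩ ⟨hw, hw'⟩
        have e : ∀ x y, k x y * ((u + w) y - (u + w) x)
            = k x y * (u y - u x) + k x y * (w y - w x) := fun x y => by
          simp only [ContinuousMap.add_apply]; ring
        refine ⟨fun x => ?_, ?_⟩
        · simp only [e]
          exact (hu x).add (hw x)
        · refine (hu'.add hw').congr fun x => ?_
          simp only [e]
          exact (integral_add (hu x) (hw x)).symm
      zero_mem' := by
        refine ⟨fun x => ?_, ?_⟩ <;> simp [continuous_const]
      smul_mem' := by
        rintro c u ⟨hu, hu'⟩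
        have e : ∀ x y, k x y * ((c • u) y - (c • u) x) = c * (k x y * (u y - u x)) :=
          fun x y => by simp only [ContinuousMap.smul_apply, smul_eq_mul]; ring
        refine ⟨fun x => ?_, ?_⟩
        · simp only [e]
          exact (hu x).const_mul c
        · refine (hu'.const_mul c).congr fun x => ?_
          simp only [e]
          exact (integral_const_mul c _).symm }
  toFun :=
    { toFun := fun u => ⟨fun x => ∫ y, k x y * (u.1 y - u.1 x) ∂D.measure, u.2.2⟩
      map_add' := by
        intro u w
        ext x
        simp only [ContinuousMap.coe_mk, ContinuousMap.add_apply]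
        rw [← integral_add (u.2.1 x) (w.2.1 x)]
        refine integral_congr_ae (Eventually.of_forall fun y => ?_)
        simp only [Submodule.coe_add, ContinuousMap.add_apply]
        ring
      map_smul' := by
        intro c u
        ext x
        simp only [ContinuousMap.coe_mk, ContinuousMap.smul_apply, smul_eq_mul, RingHom.id_apply]
        rw [← integral_const_mul]
        refine integral_congr_ae (Eventually.of_forall fun y => ?_)
        simp only [Submodule.coe_smul, ContinuousMap.smul_apply, smul_eq_mul]
        ring }

/-- `g(x) = lim_{ε → 0+} ∫_{y ∈ Z, |x - y|_p > ε} k(x, y) (u(y) - u(x)) dy` for all `x` in `Z`: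
the function `g` is given by the integral that defines the operator, read as an improper
integral with singularity at `y = x`. -/
def IsImproperValue (k : D.Z → D.Z → ℝ) (u g : C(D.Z, ℝ)) : Prop :=
  ∀ x : D.Z, Tendsto
    (fun ε : ℝ => ∫ y in {y : D.Z | ε < ‖(x : ℤ_[p]) - y‖}, k x y * (u y - u x) ∂D.measure)
    (𝓝[>] 0) (𝓝 (g x))

end VertexDiscs

/-- The operator `𝓗_•` for `•` one of `κ`, `d_E`, `δ`. -/
abbrev hOperator {p : ℕ} [Fact p.Prime] {V : Type*} (G : SimpleGraph V) (κ : V → V → ℝ)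
    (α : ℝ) (D : VertexDiscs p V) (b : Bullet) : C(D.Z, ℝ) →ₗ.[ℝ] C(D.Z, ℝ) :=
  D.parisiOperator (D.padicKernel α (vertexKernel G κ α b))

end

end PadicGraph

set_option linter.unusedSectionVars false

namespace PadicGraph

/-! ### Bounded operators `A` with `‖A + C‖ ≤ C` and their exponentials. -/

section Exponential

variable {E : Type*} [NormedAddCommGroup E] [NormedSpace ℝ E] [CompleteSpace E]

/-! Let `r` be a positive lower bound for the radii of the discs. A ball of radius `ε ≤ r` lies in a
single disc, so the kernel is constant on products of two disjoint such balls. Cutting it off at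
distances at most `ε` leaves a locally constant kernel, whose jump operator `A_ε` is bounded. With
`C` the largest total jump rate, `A_ε + C` is positive of norm at most `C`, so `exp (t A_ε)` is a
positive contraction. Functions constant on `ε`-balls form an `A_ε`-invariant space `W_ε`, on which
every `A_δ` with `δ ≤ ε` agrees with `A_ε`; the union of the `W_ε` is dense.

Hence the `exp (t A_ε)` converge strongly to a Feller semigroup. Its generator `L` is the closure of
the operator on the union of the `W_ε` (the core): `1 - closure` is onto by a Neumann series and
dissipativity, and `1 - L` is injective (`isGeneratorPair_limitSemigroup_iff`).

It remains to compare with the improper integral. The estimate `norm_jumpOp_trunc_sub_le` bounds the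
error of truncating at `ε` by the oscillation of the image alone, so it survives graph limits: the
improper integral extends the closure of the core. It also obeys the maximum principle, so one minus
it is injective and the two coincide. The absolutely convergent operator lies between the core and
the improper integral, hence has the same closure. A semigroup with this generator must be `exp (t
A_ε)` on each `W_ε`, which gives uniqueness. -/

theorem hasSum_exp_apply (A : E →L[ℝ] E) (f : E) :
    HasSum (fun n : ℕ => ((n.factorial : ℝ)⁻¹) • (A ^ n) f) (NormedSpace.exp A f) :=
  (NormedSpace.exp_series_hasSum_exp' (𝕂 := ℝ) A).mapL (ContinuousLinearMap.apply ℝ E f)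

theorem exp_add_smul (A : E →L[ℝ] E) (s t : ℝ) :
    NormedSpace.exp ((s + t) • A) = NormedSpace.exp (s • A) * NormedSpace.exp (t • A) := by
  let : NormedAlgebra ℚ (E →L[ℝ] E) := NormedAlgebra.restrictScalars ℚ ℝ _
  rw [add_smul]
  exact NormedSpace.exp_add_of_commute (((Commute.refl A).smul_left s).smul_right t)

theorem hasDerivAt_exp_smul_apply (A : E →L[ℝ] E) (f : E) (t : ℝ) :
    HasDerivAt (fun s : ℝ => NormedSpace.exp (s • A) f) (A (NormedSpace.exp (t • A) f)) t :=
  ((ContinuousLinearMap.apply ℝ E f).hasFDerivAt.comp_hasDerivAt t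
    (hasDerivAt_exp_smul_const' (𝕂 := ℝ) A t))

theorem continuous_exp_smul_apply (A : E →L[ℝ] E) (f : E) :
    Continuous fun s : ℝ => NormedSpace.exp (s • A) f :=
  continuous_iff_continuousAt.2 fun t => (hasDerivAt_exp_smul_apply A f t).continuousAt

theorem exp_smul_add_smul_one (A : E →L[ℝ] E) (C t : ℝ) (f : E) :
    NormedSpace.exp (t • (A + C • 1)) f = Real.exp (t * C) • NormedSpace.exp (t • A) f := by
  let : NormedAlgebra ℚ (E →L[ℝ] E) := NormedAlgebra.restrictScalars ℚ ℝ _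
  have h1 : t • (A + C • (1 : E →L[ℝ] E)) = algebraMap ℝ (E →L[ℝ] E) (t * C) + t • A := by
    rw [Algebra.algebraMap_eq_smul_one, smul_add, smul_smul, add_comm]
  have h2 : NormedSpace.exp (algebraMap ℝ (E →L[ℝ] E) (t * C))
      = algebraMap ℝ (E →L[ℝ] E) (Real.exp (t * C)) := by
    rw [Real.exp_eq_exp_ℝ]
    exact (NormedSpace.algebraMap_exp_comm (𝕂 := ℝ) (t * C)).symm
  rw [h1, NormedSpace.exp_add_of_commute (Algebra.commutes _ _), h2,
    Algebra.algebraMap_eq_smul_one]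
  simp

/-- The series is bounded on vectors, so its zeroth term does not need `‖1‖ = 1`, which fails for `E
= 0`. -/
theorem norm_exp_apply_le (A : E →L[ℝ] E) (f : E) :
    ‖NormedSpace.exp A f‖ ≤ Real.exp ‖A‖ * ‖f‖ := by
  have h : HasSum (fun n : ℕ => ((n.factorial : ℝ)⁻¹ • ‖A‖ ^ n) * ‖f‖) (Real.exp ‖A‖ * ‖f‖) := by
    rw [Real.exp_eq_exp_ℝ]
    exact (NormedSpace.exp_series_hasSum_exp' (𝕂 := ℝ) ‖A‖).mul_right _
  refine (hasSum_exp_apply A f).norm_le_of_bounded h fun n => ?_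
  rw [norm_smul, Real.norm_of_nonneg (by positivity), smul_eq_mul, mul_assoc]
  gcongr
  exact (le_of_opNorm_le_pow A n f)
where
  le_of_opNorm_le_pow (A : E →L[ℝ] E) (n : ℕ) (f : E) : ‖(A ^ n) f‖ ≤ ‖A‖ ^ n * ‖f‖ := by
    induction n with
    | zero => simp
    | succ n ih =>
      rw [pow_succ', pow_succ', mul_apply_eq_comp, mul_assoc]
      exact (A.le_opNorm _).trans (by gcongr)

/-- If `‖A + C‖ ≤ C`, then `A` generates a semigroup of contractions. -/
theorem norm_exp_smul_apply_le {A : E →L[ℝ] E} {C : ℝ} (hA : ‖A + C • 1‖ ≤ C) {t : ℝ}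
    (ht : 0 ≤ t) (f : E) : ‖NormedSpace.exp (t • A) f‖ ≤ ‖f‖ := by
  have h := norm_exp_apply_le (t • (A + C • 1)) f
  rw [exp_smul_add_smul_one, norm_smul, Real.norm_of_nonneg (Real.exp_pos _).le] at h
  have h' : Real.exp ‖t • (A + C • (1 : E →L[ℝ] E))‖ ≤ Real.exp (t * C) := by
    rw [norm_smul, Real.norm_of_nonneg ht]
    gcongr
  have h2 := h.trans (mul_le_mul_of_nonneg_right h' (norm_nonneg f))
  exact le_of_mul_le_mul_left h2 (Real.exp_pos _)

/-- Dissipativity of `A`: split `(1 + C) f` as `(f - A f) + (A + C) f` and absorb the second term.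
-/
theorem norm_le_norm_sub_apply {A : E →L[ℝ] E} {C : ℝ} (hA : ‖A + C • 1‖ ≤ C) (f : E) :
    ‖f‖ ≤ ‖f - A f‖ := by
  have h1 : (1 + C) • f = (f - A f) + (A + C • (1 : E →L[ℝ] E)) f := by
    simp only [add_apply, smul_apply,
      one_apply_eq_self, add_smul, one_smul]
    abel
  have hC : 0 ≤ C := (norm_nonneg _).trans hA
  have h2 : (1 + C) * ‖f‖ ≤ ‖f - A f‖ + C * ‖f‖ := by
    rw [← Real.norm_of_nonneg (by positivity : 0 ≤ 1 + C), ← norm_smul, h1]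
    exact (norm_add_le _ _).trans (by
      gcongr
      exact ContinuousLinearMap.le_of_opNorm_le _ hA f)
  linarith

variable {A : E →L[ℝ] E} {W : Submodule ℝ E}

theorem pow_apply_mem (hA : ∀ f ∈ W, A f ∈ W) {f : E} (hf : f ∈ W) (n : ℕ) :
    (A ^ n) f ∈ W := by
  induction n with
  | zero => simpa
  | succ n ih =>
    rw [pow_succ', mul_apply_eq_comp]
    exact hA _ ih

theorem exp_smul_apply_mem (hW : IsClosed (W : Set E)) (hA : ∀ f ∈ W, A f ∈ W) {f : E}
    (hf : f ∈ W) (t : ℝ) : NormedSpace.exp (t • A) f ∈ W :=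
  hW.mem_of_tendsto (hasSum_exp_apply (t • A) f) (Eventually.of_forall fun _ =>
    W.sum_mem fun n _ => W.smul_mem _
      (pow_apply_mem (A := t • A) (fun g hg => W.smul_mem t (hA g hg)) hf n))

theorem exp_smul_apply_congr {B : E →L[ℝ] E} (hA : ∀ f ∈ W, A f ∈ W)
    (hB : ∀ f ∈ W, B f = A f) {f : E} (hf : f ∈ W) (t : ℝ) :
    NormedSpace.exp (t • B) f = NormedSpace.exp (t • A) f := by
  refine (hasSum_exp_apply (t • B) f).unique ?_
  convert hasSum_exp_apply (t • A) f using 2 with n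
  congr 1
  induction n with
  | zero => simp
  | succ n ih =>
    rw [pow_succ', pow_succ', mul_apply_eq_comp, mul_apply_eq_comp, ih]
    simp only [smul_apply]
    rw [hB _ (pow_apply_mem (A := t • A) (fun g hg => W.smul_mem t (hA g hg)) hf n)]

/-- If `A + C` preserves a closed convex cone, then so does `exp (t A)` for `t ≥ 0`. -/
theorem exp_smul_apply_mem_cone {K : Submodule ℝ≥0 E} (hK : IsClosed (K : Set E)) {C : ℝ}
    (hA : ∀ f ∈ K, (A + C • 1) f ∈ K) {f : E} (hf : f ∈ K) (t : ℝ≥0) :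
    NormedSpace.exp ((t : ℝ) • A) f ∈ K := by
  have hpow : ∀ n : ℕ, (((t : ℝ) • (A + C • (1 : E →L[ℝ] E))) ^ n) f ∈ K := by
    intro n
    induction n with
    | zero => simpa
    | succ n ih =>
      rw [pow_succ', mul_apply_eq_comp]
      exact K.smul_mem t (hA _ ih)
  have hmem : NormedSpace.exp ((t : ℝ) • (A + C • (1 : E →L[ℝ] E))) f ∈ K :=
    hK.mem_of_tendsto (hasSum_exp_apply _ f) (Eventually.of_forall fun _ =>
      K.sum_mem fun n _ => K.smul_mem ⟨(n.factorial : ℝ)⁻¹, by positivity⟩ (hpow n))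
  rw [exp_smul_add_smul_one] at hmem
  have h : Real.exp (-(t * C)) • Real.exp (t * C) • NormedSpace.exp ((t : ℝ) • A) f ∈ K :=
    K.smul_mem ⟨Real.exp (-(t * C)), (Real.exp_pos _).le⟩ hmem
  rwa [smul_smul, ← Real.exp_add, neg_add_cancel, Real.exp_zero, one_smul] at h

/-- Since `1 - A = (1 + C) (1 - Q)` with `Q = (A + C) / (1 + C)` of norm below one, a Neumann series
solves the equation; its partial sums stay in the closed subspace `W`. -/
theorem exists_sub_apply_eq {C : ℝ} (hC : ‖A + C • 1‖ ≤ C) (hW : IsClosed (W : Set E))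
    (hA : ∀ f ∈ W, A f ∈ W) {f : E} (hf : f ∈ W) : ∃ u ∈ W, u - A u = f := by
  have hC0 : 0 ≤ C := (norm_nonneg _).trans hC
  have h1C : 0 < 1 + C := by positivity
  set Q : E →L[ℝ] E := (1 + C)⁻¹ • (A + C • 1) with hQ
  have hQn : ‖Q‖ < 1 := by
    rw [hQ, norm_smul, Real.norm_of_nonneg (by positivity), inv_mul_lt_iff₀ h1C]
    linarith
  have hQW : ∀ g ∈ W, Q g ∈ W := fun g hg =>
    W.smul_mem _ (W.add_mem (hA g hg) (W.smul_mem _ hg))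
  have hs : Summable fun n : ℕ => Q ^ n := summable_geometric_of_norm_lt_one hQn
  have hsum : HasSum (fun n : ℕ => (Q ^ n) ((1 + C)⁻¹ • f))
      ((∑' n : ℕ, Q ^ n) ((1 + C)⁻¹ • f)) :=
    hs.hasSum.mapL (ContinuousLinearMap.apply ℝ E ((1 + C)⁻¹ • f))
  refine ⟨_, hW.mem_of_tendsto hsum (Eventually.of_forall fun _ =>
    W.sum_mem fun n _ => pow_apply_mem hQW (W.smul_mem _ hf) n), ?_⟩
  have hmul : (1 - Q) * ∑' n : ℕ, Q ^ n = 1 := mul_neg_geom_series Q hQn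
  have key := congrArg (fun B : E →L[ℝ] E => B ((1 + C)⁻¹ • f)) hmul
  simp only [mul_apply_eq_comp, one_apply_eq_self,
    sub_apply] at key
  set u := (∑' n : ℕ, Q ^ n) ((1 + C)⁻¹ • f)
  have key2 := congrArg (fun v => (1 + C) • v) key
  simp only [hQ, smul_sub, smul_apply, add_apply,
    one_apply_eq_self, smul_inv_smul₀ h1C.ne'] at key2
  rw [← key2, add_smul, one_smul]
  abel

end Exponential

/-! ### Contraction semigroups: injectivity of one minus the generator, and uniqueness. -/

/-- A strongly continuous one-parameter semigroup of contractions of a Banach space. -/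
structure IsContractionSemigroup {E : Type*} [NormedAddCommGroup E] [NormedSpace ℝ E]
    (T : ℝ≥0 → E →L[ℝ] E) : Prop where
  map_zero : T 0 = ContinuousLinearMap.id ℝ E
  map_add : ∀ s t : ℝ≥0, T (s + t) = (T s).comp (T t)
  strongly_continuous : ∀ f : E, Continuous fun t => T t f
  contraction : ∀ (t : ℝ≥0) (f : E), ‖T t f‖ ≤ ‖f‖

theorem IsFellerSemigroup.isContractionSemigroup {X : Type*} [TopologicalSpace X] [CompactSpace X]
    {T : ℝ≥0 → C(X, ℝ) →L[ℝ] C(X, ℝ)} (hT : IsFellerSemigroup T) : IsContractionSemigroup T :=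
  ⟨hT.map_zero, hT.map_add, hT.strongly_continuous, hT.contraction⟩

section ContractionSemigroup

variable {E : Type*} [NormedAddCommGroup E] [NormedSpace ℝ E]

theorem tendsto_coe_nhdsGT_zero :
    Tendsto (fun t : ℝ≥0 => (t : ℝ)) (𝓝[>] 0) (𝓝[>] 0) :=
  tendsto_nhdsWithin_iff.2 ⟨(NNReal.continuous_coe.tendsto' 0 0 rfl).mono_left nhdsWithin_le_nhds,
    eventually_nhdsWithin_of_forall fun _ ht => NNReal.coe_pos.2 ht⟩

theorem tendsto_toNNReal_sub_nhdsGT (s : ℝ) :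
    Tendsto (fun r : ℝ => (r - s).toNNReal) (𝓝[>] s) (𝓝[>] 0) := by
  refine tendsto_nhdsWithin_iff.2 ⟨?_,
    eventually_nhdsWithin_of_forall fun r hr => Real.toNNReal_pos.2 (sub_pos.2 hr)⟩
  have h : Continuous fun r : ℝ => (r - s).toNNReal := by fun_prop
  exact (h.tendsto' s 0 (by simp)).mono_left nhdsWithin_le_nhds

namespace IsContractionSemigroup

variable {S : ℝ≥0 → E →L[ℝ] E}

/-- Strong continuity becomes joint continuity because contractions are equicontinuous. -/
theorem tendsto_apply (hS : IsContractionSemigroup S) {ι : Type*} {l : Filter ι} {τ : ι → ℝ≥0}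
    {t : ℝ≥0} {c : ι → E} {c₀ : E} (hτ : Tendsto τ l (𝓝 t)) (hc : Tendsto c l (𝓝 c₀)) :
    Tendsto (fun i => S (τ i) (c i)) l (𝓝 (S t c₀)) := by
  have h1 : Tendsto (fun i => S (τ i) c₀) l (𝓝 (S t c₀)) :=
    ((hS.strongly_continuous c₀).tendsto t).comp hτ
  have h2 : Tendsto (fun i => S (τ i) (c i - c₀)) l (𝓝 0) := by
    refine squeeze_zero_norm (fun i => hS.contraction _ _) ?_
    simpa using (hc.sub_const c₀).norm
  simpa using h2.add h1

/-- Here `S t v = (1 + t) v + o(t)`, a growth that contractivity forbids unless `v = 0`. -/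
theorem eq_zero_of_isGeneratorPair_self (hS : IsContractionSemigroup S) {v : E}
    (hv : IsGeneratorPair S v v) : v = 0 := by
  have h : Tendsto (fun t : ℝ≥0 => ‖(t : ℝ)⁻¹ • (S t v - v) - v‖) (𝓝[>] 0) (𝓝 0) := by
    simpa using (hv.sub_const v).norm
  refine norm_le_zero_iff.1 (ge_of_tendsto h (eventually_nhdsWithin_of_forall fun t ht => ?_))
  have ht' : (0 : ℝ) < t := NNReal.coe_pos.2 ht
  have e : (1 + (t : ℝ)⁻¹) • v = (t : ℝ)⁻¹ • S t v - ((t : ℝ)⁻¹ • (S t v - v) - v) := by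
    rw [add_smul, one_smul, smul_sub]
    abel
  have h1 : (1 + (t : ℝ)⁻¹) * ‖v‖ ≤ (t : ℝ)⁻¹ * ‖v‖ + ‖(t : ℝ)⁻¹ • (S t v - v) - v‖ := by
    rw [← Real.norm_of_nonneg (by positivity : 0 ≤ 1 + (t : ℝ)⁻¹), ← norm_smul, e]
    refine (norm_sub_le _ _).trans ?_
    gcongr
    rw [norm_smul, Real.norm_of_nonneg (by positivity)]
    gcongr
    exact hS.contraction t v
  linarith

/-- If the generator of a contraction semigroup `S` agrees with a bounded operator `A` on a closed
`A`-invariant subspace, then so does `S t` with `exp (t A)`. -/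
theorem apply_eq_exp [CompleteSpace E] (hS : IsContractionSemigroup S) {A : E →L[ℝ] E}
    {W : Submodule ℝ E} (hW : IsClosed (W : Set E)) (hA : ∀ f ∈ W, A f ∈ W)
    (hgen : ∀ f ∈ W, IsGeneratorPair S f (A f)) (t : ℝ≥0) {u : E} (hu : u ∈ W) :
    S t u = NormedSpace.exp ((t : ℝ) • A) u := by
  set v := NormedSpace.exp ((t : ℝ) • A) u with hv
  have hvW : v ∈ W := exp_smul_apply_mem hW hA hu _
  have hexp : ∀ r s : ℝ, NormedSpace.exp ((-r) • A) v
      = NormedSpace.exp ((-(r - s)) • A) (NormedSpace.exp ((-s) • A) v) := fun r s => by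
    rw [show -r = -(r - s) + -s by ring, exp_add_smul, mul_apply_eq_comp]
  -- The function `s ↦ S s (exp ((t - s) A) u)` interpolates between the two sides; it is constant
  -- because its right derivative vanishes. Only right derivatives are accessible through the
  -- generator of `S`.
  set φ : ℝ → E := fun s => S s.toNNReal (NormedSpace.exp ((-s) • A) v) with hφ
  have hcont : Continuous φ := continuous_iff_continuousAt.2 fun s =>
    hS.tendsto_apply (continuous_real_toNNReal.tendsto s)
      (((continuous_exp_smul_apply A v).comp continuous_neg).tendsto s)
  have hderiv : ∀ s ∈ Set.Ico (0 : ℝ) t, HasDerivWithinAt φ 0 (Set.Ici s) s := by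
    intro s hs
    rw [← hasDerivWithinAt_Ioi_iff_Ici, hasDerivWithinAt_iff_tendsto_slope' (by simp)]
    set w := NormedSpace.exp ((-s) • A) v with hw
    have hwW : w ∈ W := exp_smul_apply_mem hW hA hvW _
    have hd : Tendsto (fun r : ℝ≥0 => (r : ℝ)⁻¹ • (NormedSpace.exp ((-(r : ℝ)) • A) w - w))
        (𝓝[>] 0) (𝓝 (-(A w))) := by
      have h := ((hasDerivAt_exp_smul_apply (-A) w 0).tendsto_slope_zero_right).comp
        tendsto_coe_nhdsGT_zero
      simpa [Function.comp_def] using h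
    -- The difference quotient is `S s` applied to `S r ((exp (-r A) w - w) / r) + (S r w - w) / r`,
    -- which tends to `-A w + A w = 0`.
    have h1 := hS.tendsto_apply (τ := fun r : ℝ≥0 => r)
      (tendsto_id.mono_left (nhdsWithin_le_nhds (a := (0 : ℝ≥0)) (s := Set.Ioi 0))) hd
    have h2 := (h1.add (hgen w hwW))
    rw [hS.map_zero, ContinuousLinearMap.id_apply, neg_add_cancel] at h2
    have h3 := ((S s.toNNReal).continuous.tendsto' 0 0 (_root_.map_zero _)).comp
      (h2.comp (tendsto_toNNReal_sub_nhdsGT s))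
    refine h3.congr' (eventually_nhdsWithin_of_forall fun r hr => ?_)
    have hr' : 0 < r - s := sub_pos.2 hr
    have hrr : r.toNNReal = s.toNNReal + (r - s).toNNReal := by
      rw [← Real.toNNReal_add hs.1 hr'.le]
      congr 1
      ring
    simp only [Function.comp_apply, slope, hφ, vsub_eq_sub, Real.coe_toNNReal _ hr'.le]
    rw [hrr, hS.map_add, ContinuousLinearMap.comp_apply, hexp r s, ← hw, ← map_sub (S s.toNNReal),
      ← map_smul (S s.toNNReal), map_smul (S (r - s).toNNReal), ← smul_add,
      map_sub (S (r - s).toNNReal)]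
    congr 2
    abel
  have h := constant_of_has_deriv_right_zero hcont.continuousOn hderiv t ⟨t.2, le_rfl⟩
  have hback : NormedSpace.exp ((-(t : ℝ)) • A) v = u := by
    rw [hv, ← mul_apply_eq_comp, ← exp_add_smul]
    simp
  simp only [hφ, Real.toNNReal_coe, hback, Real.toNNReal_zero, hS.map_zero] at h
  simpa using h

end IsContractionSemigroup

end ContractionSemigroup

/-! ### Generation of a semigroup from compatible bounded operators on an exhaustion. -/

section Exhaustion

variable {E : Type*} [NormedAddCommGroup E] [NormedSpace ℝ E]

/-- An increasing sequence `W` of closed subspaces with dense union, and bounded operators `A n`,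
generators of contraction semigroups, such that `A n` preserves `W n` and extends the restrictions
of all previous ones. -/
structure IsExhaustion (A : ℕ → E →L[ℝ] E) (W : ℕ → Submodule ℝ E) : Prop where
  mono : Monotone W
  isClosed : ∀ n, IsClosed (W n : Set E)
  mapsTo : ∀ n, ∀ f ∈ W n, A n f ∈ W n
  agree : ∀ m n, m ≤ n → ∀ f ∈ W m, A n f = A m f
  dense : Dense (⋃ n, (W n : Set E))
  bound : ∀ n, ∃ C : ℝ, ‖A n + C • 1‖ ≤ C

/-- The graph of the common extension of the restrictions of `A n` to `W n`. -/
def coreGraph (A : ℕ → E →L[ℝ] E) (W : ℕ → Submodule ℝ E) : Set (E × E) :=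
  {q | ∃ n, q.1 ∈ W n ∧ A n q.1 = q.2}

namespace IsExhaustion

variable {A : ℕ → E →L[ℝ] E} {W : ℕ → Submodule ℝ E}

theorem ext_of_dense (h : IsExhaustion A W) {S T : E →L[ℝ] E}
    (hST : ∀ n, ∀ f ∈ W n, S f = T f) : S = T := by
  refine ContinuousLinearMap.ext fun f => congrFun (Continuous.ext_on h.dense S.continuous
    T.continuous fun g hg => ?_) f
  obtain ⟨n, hn⟩ := Set.mem_iUnion.1 hg
  exact hST n g hn

theorem exists_mem_norm_sub_lt (h : IsExhaustion A W) (f : E) {ε : ℝ} (hε : 0 < ε) :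
    ∃ n, ∃ w ∈ W n, ‖f - w‖ < ε := by
  obtain ⟨w, hw, hd⟩ := Metric.mem_closure_iff.1 (h.dense f) ε hε
  obtain ⟨n, hn⟩ := Set.mem_iUnion.1 hw
  exact ⟨n, w, hn, by rwa [← dist_eq_norm]⟩

variable [CompleteSpace E]

theorem exp_apply_eq (h : IsExhaustion A W) {m n : ℕ} (hmn : m ≤ n) {f : E} (hf : f ∈ W m)
    (t : ℝ) : NormedSpace.exp (t • A n) f = NormedSpace.exp (t • A m) f :=
  exp_smul_apply_congr (h.mapsTo m) (h.agree m n hmn) hf t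

theorem norm_exp_apply_le (h : IsExhaustion A W) (n : ℕ) {t : ℝ} (ht : 0 ≤ t) (f : E) :
    ‖NormedSpace.exp (t • A n) f‖ ≤ ‖f‖ := by
  obtain ⟨C, hC⟩ := h.bound n
  exact norm_exp_smul_apply_le hC ht f

/-- On a vector of some `W N` the sequence is constant from `N` on; contractivity transfers the
Cauchy property to limits of such vectors. -/
theorem exists_tendsto_exp (h : IsExhaustion A W) (t : ℝ≥0) (f : E) :
    ∃ g, Tendsto (fun n => NormedSpace.exp ((t : ℝ) • A n) f) atTop (𝓝 g) := by
  refine cauchySeq_tendsto_of_complete (Metric.cauchySeq_iff'.2 fun ε hε => ?_)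
  obtain ⟨N, w, hw, hfw⟩ := h.exists_mem_norm_sub_lt f (half_pos hε)
  refine ⟨N, fun n hn => ?_⟩
  have e : NormedSpace.exp ((t : ℝ) • A n) f - NormedSpace.exp ((t : ℝ) • A N) f
      = NormedSpace.exp ((t : ℝ) • A n) (f - w) - NormedSpace.exp ((t : ℝ) • A N) (f - w) := by
    rw [map_sub, map_sub, h.exp_apply_eq hn hw]
    abel
  rw [dist_eq_norm, e]
  have h1 := h.norm_exp_apply_le n t.2 (f - w)
  have h2 := h.norm_exp_apply_le N t.2 (f - w)
  exact (norm_sub_le _ _).trans_lt (by linarith!)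

/-- The strong limit of the semigroups `exp (t A n)`. -/
noncomputable def limitSemigroup (h : IsExhaustion A W) (t : ℝ≥0) : E →L[ℝ] E :=
  continuousLinearMapOfTendsto (fun n => NormedSpace.exp ((t : ℝ) • A n))
    (tendsto_pi_nhds.2 fun f => (h.exists_tendsto_exp t f).choose_spec)

theorem tendsto_limitSemigroup (h : IsExhaustion A W) (t : ℝ≥0) (f : E) :
    Tendsto (fun n => NormedSpace.exp ((t : ℝ) • A n) f) atTop (𝓝 (h.limitSemigroup t f)) :=
  (h.exists_tendsto_exp t f).choose_spec

theorem limitSemigroup_apply (h : IsExhaustion A W) (t : ℝ≥0) {n : ℕ} {f : E} (hf : f ∈ W n) :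
    h.limitSemigroup t f = NormedSpace.exp ((t : ℝ) • A n) f :=
  tendsto_nhds_unique (h.tendsto_limitSemigroup t f) (tendsto_const_nhds.congr'
    ((eventually_ge_atTop n).mono fun _ hm => (h.exp_apply_eq hm hf t).symm))

theorem isContractionSemigroup_limitSemigroup (h : IsExhaustion A W) :
    IsContractionSemigroup h.limitSemigroup := by
  have hcontr : ∀ (t : ℝ≥0) (f : E), ‖h.limitSemigroup t f‖ ≤ ‖f‖ := fun t f =>
    le_of_tendsto (h.tendsto_limitSemigroup t f).norm
      (Eventually.of_forall fun n => h.norm_exp_apply_le n t.2 f)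
  refine ⟨h.ext_of_dense fun n f hf => ?_, fun s t => h.ext_of_dense fun n f hf => ?_,
    fun f => ?_, hcontr⟩
  · simp [h.limitSemigroup_apply 0 hf]
  · rw [ContinuousLinearMap.comp_apply, h.limitSemigroup_apply _ hf, h.limitSemigroup_apply _ hf,
      h.limitSemigroup_apply s (exp_smul_apply_mem (h.isClosed n) (h.mapsTo n) hf _),
      NNReal.coe_add, exp_add_smul, mul_apply_eq_comp]
  · refine continuous_of_uniform_approx_of_continuous fun U hU => ?_
    obtain ⟨ε, hε, hU⟩ := Metric.mem_uniformity_dist.1 hU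
    obtain ⟨n, w, hw, hfw⟩ := h.exists_mem_norm_sub_lt f hε
    refine ⟨fun t => h.limitSemigroup t w, ?_, fun t => hU ?_⟩
    · simp only [h.limitSemigroup_apply _ hw]
      exact (continuous_exp_smul_apply (A n) w).comp NNReal.continuous_coe
    · rw [dist_eq_norm, ← map_sub]
      exact (hcontr t _).trans_lt hfw

theorem limitSemigroup_apply_mem_cone (h : IsExhaustion A W) {K : Submodule ℝ≥0 E}
    (hK : IsClosed (K : Set E)) (hA : ∀ n, ∃ C : ℝ, ∀ f ∈ K, (A n + C • 1) f ∈ K) {f : E}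
    (hf : f ∈ K) (t : ℝ≥0) : h.limitSemigroup t f ∈ K :=
  hK.mem_of_tendsto (h.tendsto_limitSemigroup t f) (Eventually.of_forall fun n => by
    obtain ⟨C, hC⟩ := hA n
    exact exp_smul_apply_mem_cone hK hC hf t)

/-- Integrate the derivative `S s (A u) - g`. The vector `g` is kept independent of `q.2` so that
the bound is continuous in `q` and extends to the closure of the core. -/
theorem norm_limitSemigroup_sub_le (h : IsExhaustion A W) (t : ℝ≥0) {g : E} {c : ℝ}
    (hc : ∀ s ≤ t, ‖h.limitSemigroup s g - g‖ ≤ c) {q : E × E} (hq : q ∈ coreGraph A W) :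
    ‖h.limitSemigroup t q.1 - q.1 - (t : ℝ) • g‖ ≤ (‖q.2 - g‖ + c) * t := by
  obtain ⟨u, v⟩ := q
  obtain ⟨n, hu, hv⟩ := hq
  dsimp only at hu hv ⊢
  subst hv
  have hS := h.isContractionSemigroup_limitSemigroup
  set φ : ℝ → E := fun s => NormedSpace.exp (s • A n) u - s • g
  have hφ : ∀ s, HasDerivAt φ (A n (NormedSpace.exp (s • A n) u) - g) s := fun s => by
    have := (hasDerivAt_exp_smul_apply (A n) u s).sub ((hasDerivAt_id s).smul_const g)
    rwa [one_smul] at this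
  have hbound : ∀ s ∈ Set.Ico (0 : ℝ) t,
      ‖A n (NormedSpace.exp (s • A n) u) - g‖ ≤ ‖A n u - g‖ + c := by
    intro s hs
    have hcomm : A n (NormedSpace.exp (s • A n) u) = NormedSpace.exp (s • A n) (A n u) := by
      rw [← mul_apply_eq_comp, ← mul_apply_eq_comp,
        (((Commute.refl (A n)).smul_right s).exp_right).eq]
    lift s to ℝ≥0 using hs.1
    rw [hcomm, ← h.limitSemigroup_apply s (h.mapsTo n u hu)]
    have e : h.limitSemigroup s (A n u) - g
        = h.limitSemigroup s (A n u - g) + (h.limitSemigroup s g - g) := by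
      rw [map_sub]
      abel
    rw [e]
    exact (norm_add_le _ _).trans (add_le_add (hS.contraction _ _)
      (hc s (NNReal.coe_le_coe.1 hs.2.le)))
  have := norm_image_sub_le_of_norm_deriv_le_segment'
    (fun s _ => (hφ s).hasDerivWithinAt) hbound t ⟨t.2, le_rfl⟩
  rw [h.limitSemigroup_apply t hu]
  simp only [φ, zero_smul, NormedSpace.exp_zero, one_apply_eq_self, sub_zero] at this
  rwa [sub_right_comm]

theorem norm_limitSemigroup_sub_le_of_mem_closure (h : IsExhaustion A W) (t : ℝ≥0) {u g : E}
    {c : ℝ} (hc : ∀ s ≤ t, ‖h.limitSemigroup s g - g‖ ≤ c)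
    (hug : (u, g) ∈ closure (coreGraph A W)) :
    ‖h.limitSemigroup t u - u - (t : ℝ) • g‖ ≤ c * t := by
  have hclosed : IsClosed {q : E × E |
      ‖h.limitSemigroup t q.1 - q.1 - (t : ℝ) • g‖ ≤ (‖q.2 - g‖ + c) * t} :=
    isClosed_le (((((h.limitSemigroup t).continuous.comp continuous_fst).sub
      continuous_fst).sub continuous_const).norm)
      (((continuous_snd.sub continuous_const).norm.add continuous_const).mul continuous_const)
  have hsub : coreGraph A W ⊆ {q : E × E |
      ‖h.limitSemigroup t q.1 - q.1 - (t : ℝ) • g‖ ≤ (‖q.2 - g‖ + c) * t} := fun q hq => by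
    rw [Set.mem_ofPred_eq]
    exact h.norm_limitSemigroup_sub_le t hc hq
  have hle := closure_minimal hsub hclosed hug
  rwa [Set.mem_ofPred_eq, sub_self, norm_zero, zero_add] at hle

theorem isGeneratorPair_of_mem_closure (h : IsExhaustion A W) {u g : E}
    (hug : (u, g) ∈ closure (coreGraph A W)) : IsGeneratorPair h.limitSemigroup u g := by
  have hS := h.isContractionSemigroup_limitSemigroup
  have hcont : ∀ ε > 0, ∀ᶠ s in 𝓝 (0 : ℝ≥0), ‖h.limitSemigroup s g - g‖ < ε / 2 := by
    intro ε hε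
    have h1 : Tendsto (fun s => ‖h.limitSemigroup s g - g‖) (𝓝 0) (𝓝 0) := by
      have h2 := (((hS.strongly_continuous g).tendsto 0).sub_const g).norm
      rwa [hS.map_zero, ContinuousLinearMap.id_apply, sub_self, norm_zero] at h2
    exact h1.eventually_lt_const (half_pos hε)
  unfold IsGeneratorPair
  rw [Metric.tendsto_nhds]
  intro ε hε
  obtain ⟨δ, hδ, hball⟩ := Metric.eventually_nhds_iff.1 (hcont ε hε)
  have hδ' : ∀ᶠ t in 𝓝[>] (0 : ℝ≥0), t ∈ Metric.ball 0 δ :=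
    nhdsWithin_le_nhds (Metric.ball_mem_nhds 0 hδ)
  filter_upwards [eventually_mem_nhdsWithin, hδ'] with t ht htδ
  have ht0 : (0 : ℝ) < t := NNReal.coe_pos.2 ht
  have hc : ∀ s ≤ t, ‖h.limitSemigroup s g - g‖ ≤ ε / 2 := fun s hs => by
    refine (hball (lt_of_le_of_lt ?_ (Metric.mem_ball.1 htδ))).le
    simpa [NNReal.dist_eq] using hs
  have hle := h.norm_limitSemigroup_sub_le_of_mem_closure t hc hug
  have e : (t : ℝ)⁻¹ • (h.limitSemigroup t u - u) - g
      = (t : ℝ)⁻¹ • (h.limitSemigroup t u - u - (t : ℝ) • g) := by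
    rw [smul_sub _ _ ((t : ℝ) • g), inv_smul_smul₀ ht0.ne']
  rw [dist_eq_norm, e, norm_smul, Real.norm_of_nonneg (by positivity), inv_mul_lt_iff₀ ht0]
  refine hle.trans_lt ?_
  rw [mul_comm]
  exact mul_lt_mul_of_pos_left (half_lt_self hε) ht0

/-- The range condition: solve the equation exactly for approximants of `f` in the `W n`;
dissipativity makes the solutions Cauchy. -/
theorem exists_mem_closure_sub_eq (h : IsExhaustion A W) (f : E) :
    ∃ q ∈ closure (coreGraph A W), q.1 - q.2 = f := by
  obtain ⟨w, hw, hwf⟩ := mem_closure_iff_seq_limit.1 (h.dense f)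
  choose n hn using fun k => Set.mem_iUnion.1 (hw k)
  have hex : ∀ k, ∃ u ∈ W (n k), u - A (n k) u = w k := fun k => by
    obtain ⟨C, hC⟩ := h.bound (n k)
    exact exists_sub_apply_eq hC (h.isClosed _) (h.mapsTo _) (hn k)
  choose u hu hAu using hex
  have hdist : ∀ k l, ‖u k - u l‖ ≤ ‖w k - w l‖ := fun k l => by
    -- At the larger index a single operator serves both solutions.
    obtain ⟨C, hC⟩ := h.bound (max (n k) (n l))
    refine (norm_le_norm_sub_apply hC (u k - u l)).trans_eq ?_
    rw [map_sub, h.agree _ _ (le_max_left _ _) _ (hu k), h.agree _ _ (le_max_right _ _) _ (hu l),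
      ← hAu k, ← hAu l]
    congr 1
    abel
  have hcauchy : CauchySeq u := by
    have hwc := hwf.cauchySeq
    rw [Metric.cauchySeq_iff] at hwc ⊢
    intro ε hε
    obtain ⟨N, hN⟩ := hwc ε hε
    refine ⟨N, fun k hk l hl => ?_⟩
    rw [dist_eq_norm]
    exact (hdist k l).trans_lt (by simpa [dist_eq_norm] using hN k hk l hl)
  obtain ⟨v, hv⟩ := cauchySeq_tendsto_of_complete hcauchy
  refine ⟨(v, v - f), mem_closure_of_tendsto (hv.prodMk_nhds (hv.sub hwf))
    (Eventually.of_forall fun k => ⟨n k, hu k, ?_⟩), by simp⟩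
  simp [← hAu k]

/-- The generator extends the closure of the core. As `1 - closure` is onto and `1 - generator` is
injective, the extension is not proper. -/
theorem isGeneratorPair_limitSemigroup_iff (h : IsExhaustion A W) {u g : E} :
    IsGeneratorPair h.limitSemigroup u g ↔ (u, g) ∈ closure (coreGraph A W) := by
  refine ⟨fun hug => ?_, h.isGeneratorPair_of_mem_closure⟩
  obtain ⟨⟨u', g'⟩, hq, hsub⟩ := h.exists_mem_closure_sub_eq (u - g)
  have hd := hug.add ((h.isGeneratorPair_of_mem_closure hq).smul (-1))
  have e : g + (-1 : ℝ) • g' = u + (-1 : ℝ) • u' := by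
    simp only [neg_smul, one_smul, ← sub_eq_add_neg]
    simp only at hsub
    rw [sub_eq_sub_iff_add_eq_add] at hsub ⊢
    rw [add_comm g, hsub]
  rw [e] at hd
  have h0 := h.isContractionSemigroup_limitSemigroup.eq_zero_of_isGeneratorPair_self hd
  have hu : u = u' := by simpa [← sub_eq_add_neg, sub_eq_zero] using h0
  subst hu
  have hg : g' = g := by simpa using hsub
  rwa [← hg]

theorem eq_limitSemigroup (h : IsExhaustion A W) {S : ℝ≥0 → E →L[ℝ] E}
    (hS : IsContractionSemigroup S) (hgen : ∀ q ∈ coreGraph A W, IsGeneratorPair S q.1 q.2) :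
    S = h.limitSemigroup := by
  funext t
  refine h.ext_of_dense fun n f hf => ?_
  rw [h.limitSemigroup_apply t hf]
  exact hS.apply_eq_exp (h.isClosed n) (h.mapsTo n) (fun g hg => hgen (g, A n g) ⟨n, hg, rfl⟩) t hf

end IsExhaustion

end Exhaustion

/-! ### Jump operators of continuous kernels. -/

section KernelOperators

variable {X : Type*} [MetricSpace X] [CompactSpace X] [MeasurableSpace X] [BorelSpace X]
  (μ : Measure X) [IsFiniteMeasure μ]

theorem integrable_of_continuous {Y : Type*} [TopologicalSpace Y] [CompactSpace Y]
    [MeasurableSpace Y] [OpensMeasurableSpace Y] (ν : Measure Y) [IsFiniteMeasure ν] {f : Y → ℝ}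
    (hf : Continuous f) : Integrable f ν :=
  hf.integrable_of_hasCompactSupport (HasCompactSupport.of_compactSpace f)

/-- The integral operator `u ↦ (x ↦ ∫ q(x, y) u(y) dy)` of a continuous kernel `q`. -/
noncomputable def kernelOp (q : C(X × X, ℝ)) : C(X, ℝ) →L[ℝ] C(X, ℝ) :=
  LinearMap.mkContinuous
    { toFun := fun u => ⟨fun x => ∫ y, q (x, y) * u y ∂μ, by
        have h := continuous_parametric_integral_of_continuous (μ := μ)
          (f := fun x y : X => q (x, y) * u y) (by
            simp only [Function.uncurry_def]
            fun_prop) isCompact_univ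
        simpa using h⟩
      map_add' := fun u v => by
        ext x
        simp only [ContinuousMap.coe_mk, ContinuousMap.add_apply, mul_add]
        exact integral_add (integrable_of_continuous μ (by fun_prop))
          (integrable_of_continuous μ (by fun_prop))
      map_smul' := fun c u => by
        ext x
        simp only [ContinuousMap.coe_mk, ContinuousMap.smul_apply, smul_eq_mul, RingHom.id_apply,
          mul_left_comm _ c]
        exact integral_const_mul c _ }
    (‖q‖ * μ.real Set.univ) fun u => by
      refine (ContinuousMap.norm_le _ (by positivity)).2 fun x => ?_
      refine (norm_integral_le_of_norm_le_const (C := ‖q‖ * ‖u‖)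
        (Eventually.of_forall fun y => ?_)).trans_eq (by ring)
      rw [norm_mul]
      gcongr
      exacts [q.norm_coe_le_norm _, u.norm_coe_le_norm _]

theorem kernelOp_apply (q : C(X × X, ℝ)) (u : C(X, ℝ)) (x : X) :
    kernelOp μ q u x = ∫ y, q (x, y) * u y ∂μ := rfl

/-- The jump operator `u ↦ (x ↦ ∫ q(x, y) (u(y) - u(x)) dy)` of a continuous kernel `q`. -/
noncomputable def jumpOp (q : C(X × X, ℝ)) : C(X, ℝ) →L[ℝ] C(X, ℝ) :=
  kernelOp μ q - ContinuousLinearMap.mul ℝ C(X, ℝ) (kernelOp μ q 1)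

theorem jumpOp_apply (q : C(X × X, ℝ)) (u : C(X, ℝ)) (x : X) :
    jumpOp μ q u x = kernelOp μ q u x - kernelOp μ q 1 x * u x := rfl

theorem jumpOp_apply_eq_integral (q : C(X × X, ℝ)) (u : C(X, ℝ)) (x : X) :
    jumpOp μ q u x = ∫ y, q (x, y) * (u y - u x) ∂μ := by
  rw [jumpOp_apply, kernelOp_apply, kernelOp_apply, ← integral_mul_const,
    ← integral_sub (integrable_of_continuous μ (by fun_prop))
      (integrable_of_continuous μ (by fun_prop))]
  simp [mul_sub]

theorem jumpOp_sub_apply (q q' : C(X × X, ℝ)) (u : C(X, ℝ)) (x : X) :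
    jumpOp μ q' u x - jumpOp μ q u x = ∫ y, (q' (x, y) - q (x, y)) * (u y - u x) ∂μ := by
  rw [jumpOp_apply_eq_integral, jumpOp_apply_eq_integral,
    ← integral_sub (integrable_of_continuous μ (by fun_prop))
      (integrable_of_continuous μ (by fun_prop))]
  simp [sub_mul]

variable {μ} {q : C(X × X, ℝ)}

theorem kernelOp_nonneg (hq : ∀ z, 0 ≤ q z) {u : C(X, ℝ)} (hu : ∀ x, 0 ≤ u x) (x : X) :
    0 ≤ kernelOp μ q u x :=
  integral_nonneg fun y => mul_nonneg (hq _) (hu y)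

theorem jumpOp_add_smul_one_apply (u : C(X, ℝ)) (x : X) (C : ℝ) :
    (jumpOp μ q + C • 1) u x = kernelOp μ q u x + (C - kernelOp μ q 1 x) * u x := by
  simp only [add_apply, smul_apply, one_apply_eq_self, ContinuousMap.add_apply,
    ContinuousMap.smul_apply, smul_eq_mul, jumpOp_apply]
  ring

/-- Shifting by the largest total rate makes the diagonal coefficient `C - c(x)` nonnegative;
together with the jump mass `c(x)` each row has total mass `C`. -/
theorem norm_jumpOp_add_smul_one_le (hq : ∀ z, 0 ≤ q z) :
    ‖jumpOp μ q + ‖kernelOp μ q 1‖ • 1‖ ≤ ‖kernelOp μ q 1‖ := by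
  refine ContinuousLinearMap.opNorm_le_bound _ (norm_nonneg _) fun u => ?_
  refine (ContinuousMap.norm_le _ (by positivity)).2 fun x => ?_
  rw [jumpOp_add_smul_one_apply]
  have hc : kernelOp μ q 1 x ≤ ‖kernelOp μ q 1‖ :=
    (le_abs_self _).trans ((kernelOp μ q 1).norm_coe_le_norm x)
  have h1 : ‖kernelOp μ q u x‖ ≤ kernelOp μ q 1 x * ‖u‖ := by
    rw [kernelOp_apply, kernelOp_apply, ← integral_mul_const]
    refine norm_integral_le_of_norm_le (integrable_of_continuous μ (by fun_prop))
      (Eventually.of_forall fun y => ?_)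
    rw [norm_mul, Real.norm_of_nonneg (hq _), ContinuousMap.one_apply, mul_one]
    exact mul_le_mul_of_nonneg_left (u.norm_coe_le_norm y) (hq _)
  have h2 : ‖(‖kernelOp μ q 1‖ - kernelOp μ q 1 x) * u x‖
      ≤ (‖kernelOp μ q 1‖ - kernelOp μ q 1 x) * ‖u‖ := by
    rw [norm_mul, Real.norm_of_nonneg (sub_nonneg.2 hc)]
    exact mul_le_mul_of_nonneg_left (u.norm_coe_le_norm x) (sub_nonneg.2 hc)
  exact (norm_add_le _ _).trans (by linarith)

theorem jumpOp_add_smul_one_nonneg (hq : ∀ z, 0 ≤ q z) {u : C(X, ℝ)} (hu : 0 ≤ u) :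
    0 ≤ (jumpOp μ q + ‖kernelOp μ q 1‖ • 1) u := by
  refine ContinuousMap.le_def.2 fun x => ?_
  rw [jumpOp_add_smul_one_apply, ContinuousMap.zero_apply]
  refine add_nonneg (kernelOp_nonneg hq hu x) (mul_nonneg ?_ (hu x))
  exact sub_nonneg.2 ((le_abs_self _).trans ((kernelOp μ q 1).norm_coe_le_norm x))

end KernelOperators

/-! ### Locally constant functions and truncated kernels on ultrametric spaces. -/

section LocallyConstant

variable {X : Type*} [MetricSpace X]

theorem continuous_of_const_on_closedBall {f : X → ℝ} {ε : ℝ} (hε : 0 < ε)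
    (hf : ∀ x y, dist x y ≤ ε → f x = f y) : Continuous f :=
  ((IsLocallyConstant.iff_eventually_eq f).2 fun x => by
    filter_upwards [Metric.closedBall_mem_nhds x hε] with y hy
    exact hf y x hy).continuous

variable (X) in
/-- The continuous functions that are constant on all closed balls of radius `ε`. -/
def constOnBalls (ε : ℝ) : Submodule ℝ C(X, ℝ) where
  carrier := {u | ∀ x y, dist x y ≤ ε → u x = u y}
  add_mem' hu hv x y h := congrArg₂ (· + ·) (hu x y h) (hv x y h)
  zero_mem' _ _ _ := rfl
  smul_mem' c _ hu x y h := congrArg (c • ·) (hu x y h)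

theorem constOnBalls_antitone {ε δ : ℝ} (h : ε ≤ δ) : constOnBalls X δ ≤ constOnBalls X ε :=
  fun _ hu x y hxy => hu x y (hxy.trans h)

theorem isClosed_constOnBalls (ε : ℝ) : IsClosed (constOnBalls X ε : Set C(X, ℝ)) := by
  have h : (constOnBalls X ε : Set C(X, ℝ))
      = ⋂ (x : X) (y : X) (_ : dist x y ≤ ε), {u : C(X, ℝ) | u x = u y} := by
    ext u
    simp only [Set.mem_iInter]
    rfl
  rw [h]
  exact isClosed_iInter fun x => isClosed_iInter fun y => isClosed_iInter fun _ =>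
    isClosed_eq (by fun_prop) (by fun_prop)

variable [IsUltrametricDist X]

theorem lt_dist_of_lt_dist {ε : ℝ} {x x' y y' : X} (hx : dist x x' ≤ ε) (hy : dist y y' ≤ ε)
    (h : ε < dist x y) : ε < dist x' y' := by
  by_contra! hle
  have h1 := dist_triangle_max x x' y
  have h2 := dist_triangle_max x' y' y
  rw [dist_comm y' y] at h2
  exact absurd (h1.trans (max_le hx (h2.trans (max_le hle hy)))) (not_le.2 h)

theorem lt_dist_iff {ε : ℝ} {x x' y y' : X} (hx : dist x x' ≤ ε) (hy : dist y y' ≤ ε) :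
    ε < dist x y ↔ ε < dist x' y' :=
  ⟨lt_dist_of_lt_dist hx hy,
    lt_dist_of_lt_dist (by rwa [dist_comm]) (by rwa [dist_comm])⟩

theorem dist_le_iff {ε : ℝ} {x x' y y' : X} (hx : dist x x' ≤ ε) (hy : dist y y' ≤ ε) :
    dist x y ≤ ε ↔ dist x' y' ≤ ε := by
  rw [← not_lt, ← not_lt, lt_dist_iff hx hy]

/-- A nonnegative kernel on an ultrametric space that is constant on products of two disjoint
balls of the same radius at most `r₀`, and symmetric at distances at most `r₀`. -/
structure IsUltrametricKernel (r₀ : ℝ) (k : X → X → ℝ) : Prop where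
  nonneg : ∀ x y, 0 ≤ k x y
  symm : ∀ x y, dist x y ≤ r₀ → k x y = k y x
  congr : ∀ ε, 0 < ε → ε ≤ r₀ → ∀ x x' y y', ε < dist x y → dist x x' ≤ ε → dist y y' ≤ ε →
    k x y = k x' y'

variable {r₀ : ℝ} {k : X → X → ℝ}

open Classical in
/-- The truncation of `k` to pairs of points of distance greater than `ε`. -/
noncomputable def IsUltrametricKernel.trunc (hk : IsUltrametricKernel r₀ k)
    (ε : Set.Ioc (0 : ℝ) r₀) : C(X × X, ℝ) where
  toFun z := if ε < dist z.1 z.2 then k z.1 z.2 else 0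
  continuous_toFun := by
    refine continuous_of_const_on_closedBall ε.2.1 fun z z' h => ?_
    rw [Prod.dist_eq, max_le_iff] at h
    have hiff := lt_dist_iff h.1 h.2
    split_ifs with h1 h2 h2
    · exact hk.congr ε ε.2.1 ε.2.2 _ _ _ _ h1 h.1 h.2
    · exact absurd (hiff.1 h1) h2
    · exact absurd (hiff.2 h2) h1
    · rfl

namespace IsUltrametricKernel

variable (hk : IsUltrametricKernel r₀ k) (ε : Set.Ioc (0 : ℝ) r₀)

theorem trunc_of_lt {x y : X} (h : ε < dist x y) : hk.trunc ε (x, y) = k x y := if_pos h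

theorem trunc_of_le {x y : X} (h : dist x y ≤ ε) : hk.trunc ε (x, y) = 0 := if_neg (not_lt.2 h)

theorem trunc_nonneg (z : X × X) : 0 ≤ hk.trunc ε z := by
  rcases lt_or_ge (ε : ℝ) (dist z.1 z.2) with h | h
  · exact (hk.nonneg _ _).trans_eq (hk.trunc_of_lt ε h).symm
  · exact (hk.trunc_of_le ε h).ge

theorem trunc_congr {x x' y y' : X} (hx : dist x x' ≤ ε) (hy : dist y y' ≤ ε) :
    hk.trunc ε (x, y) = hk.trunc ε (x', y') := by
  rcases lt_or_ge (ε : ℝ) (dist x y) with h | h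
  · rw [hk.trunc_of_lt ε h, hk.trunc_of_lt ε ((lt_dist_iff hx hy).1 h)]
    exact hk.congr ε ε.2.1 ε.2.2 _ _ _ _ h hx hy
  · rw [hk.trunc_of_le ε h, hk.trunc_of_le ε ((dist_le_iff hx hy).1 h)]

variable {δ ε : Set.Ioc (0 : ℝ) r₀}

theorem trunc_sub_trunc_of_lt (h : δ ≤ ε) {x y : X} (hxy : ε < dist x y) :
    hk.trunc δ (x, y) - hk.trunc ε (x, y) = 0 := by
  rw [hk.trunc_of_lt ε hxy, hk.trunc_of_lt δ (lt_of_le_of_lt (by exact_mod_cast h) hxy), sub_self]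

theorem trunc_sub_trunc_nonneg (h : δ ≤ ε) (x y : X) :
    0 ≤ hk.trunc δ (x, y) - hk.trunc ε (x, y) := by
  rcases lt_or_ge (ε : ℝ) (dist x y) with hxy | hxy
  · exact (hk.trunc_sub_trunc_of_lt h hxy).ge
  · rw [hk.trunc_of_le ε hxy, sub_zero]
    exact hk.trunc_nonneg δ _

/-- The difference lives at distances at most `ε ≤ r₀`, the range where `k` is known to be
symmetric. -/
theorem trunc_sub_trunc_symm (h : δ ≤ ε) (x y : X) :
    hk.trunc δ (x, y) - hk.trunc ε (x, y) = hk.trunc δ (y, x) - hk.trunc ε (y, x) := by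
  rcases lt_or_ge (ε : ℝ) (dist x y) with hxy | hxy
  · rw [hk.trunc_sub_trunc_of_lt h hxy, hk.trunc_sub_trunc_of_lt h (by rwa [dist_comm])]
  · have hyx : dist y x ≤ ε := by rwa [dist_comm]
    rw [hk.trunc_of_le ε hxy, hk.trunc_of_le ε hyx]
    rcases lt_or_ge (δ : ℝ) (dist x y) with h' | h'
    · rw [hk.trunc_of_lt δ h', hk.trunc_of_lt δ (by rwa [dist_comm]),
        hk.symm x y (hxy.trans ε.2.2)]
    · rw [hk.trunc_of_le δ h', hk.trunc_of_le δ (by rwa [dist_comm])]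

end IsUltrametricKernel

end LocallyConstant

/-! ### Averaging over balls as a conditional expectation. -/

section Average

variable {X : Type*} [MetricSpace X] [CompactSpace X] [IsUltrametricDist X] [MeasurableSpace X]
  [BorelSpace X] (μ : Measure X) [IsFiniteMeasure μ] {r₀ : ℝ}

open Classical in
/-- The kernel of the averaging operator over balls of radius `ε`. -/
noncomputable def averageKernel (ε : Set.Ioc (0 : ℝ) r₀) : C(X × X, ℝ) where
  toFun z := if dist z.1 z.2 ≤ ε then (μ.real (Metric.closedBall z.1 ε))⁻¹ else 0
  continuous_toFun := by
    refine continuous_of_const_on_closedBall ε.2.1 fun z z' h => ?_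
    rw [Prod.dist_eq, max_le_iff] at h
    rw [IsUltrametricDist.closedBall_eq_of_mem (Metric.mem_closedBall.2 h.1)]
    simp only [dist_le_iff h.1 h.2]

variable (ε : Set.Ioc (0 : ℝ) r₀)

theorem averageKernel_of_le {x y : X} (h : dist x y ≤ ε) :
    averageKernel μ ε (x, y) = (μ.real (Metric.closedBall x ε))⁻¹ := if_pos h

theorem averageKernel_of_lt {x y : X} (h : ε < dist x y) : averageKernel μ ε (x, y) = 0 :=
  if_neg (not_le.2 h)

theorem averageKernel_nonneg (z : X × X) : 0 ≤ averageKernel μ ε z := by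
  rcases lt_or_ge (ε : ℝ) (dist z.1 z.2) with h | h
  · exact (averageKernel_of_lt μ ε h).ge
  · exact (inv_nonneg.2 measureReal_nonneg).trans_eq (averageKernel_of_le μ ε h).symm

theorem averageKernel_congr {x x' y y' : X} (hx : dist x x' ≤ ε) (hy : dist y y' ≤ ε) :
    averageKernel μ ε (x, y) = averageKernel μ ε (x', y') := by
  rcases lt_or_ge (ε : ℝ) (dist x y) with h | h
  · rw [averageKernel_of_lt μ ε h, averageKernel_of_lt μ ε ((lt_dist_iff hx hy).1 h)]
  · rw [averageKernel_of_le μ ε h, averageKernel_of_le μ ε ((dist_le_iff hx hy).1 h),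
      IsUltrametricDist.closedBall_eq_of_mem (Metric.mem_closedBall.2 hx)]

theorem averageKernel_symm (x y : X) : averageKernel μ ε (x, y) = averageKernel μ ε (y, x) := by
  rcases lt_or_ge (ε : ℝ) (dist x y) with h | h
  · rw [averageKernel_of_lt μ ε h, averageKernel_of_lt μ ε (by rwa [dist_comm])]
  · have h' : dist y x ≤ ε := by rwa [dist_comm]
    rw [averageKernel_of_le μ ε h, averageKernel_of_le μ ε h',
      IsUltrametricDist.closedBall_eq_of_mem (Metric.mem_closedBall.2 h)]

theorem averageKernel_mul_congr {f : X → ℝ} (x y : X) {a : ℝ} (hf : dist x y ≤ ε → f y = a) :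
    averageKernel μ ε (x, y) * f y = averageKernel μ ε (x, y) * a := by
  rcases lt_or_ge (ε : ℝ) (dist x y) with h | h
  · rw [averageKernel_of_lt μ ε h, zero_mul, zero_mul]
  · rw [hf h]

theorem integral_averageKernel [μ.IsOpenPosMeasure] (x : X) :
    ∫ y, averageKernel μ ε (x, y) ∂μ = 1 := by
  have h : (fun y => averageKernel μ ε (x, y))
      = (Metric.closedBall x ε).indicator fun _ => (μ.real (Metric.closedBall x ε))⁻¹ := by
    funext y
    rcases lt_or_ge (ε : ℝ) (dist x y) with h | h
    · rw [averageKernel_of_lt μ ε h, Set.indicator_of_notMem (by simpa [dist_comm] using h)]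
    · rw [averageKernel_of_le μ ε h, Set.indicator_of_mem (by simpa [dist_comm] using h)]
  have hpos : 0 < μ.real (Metric.closedBall x ε) :=
    ENNReal.toReal_pos (Metric.measure_closedBall_pos μ x ε.2.1).ne' (measure_ne_top _ _)
  rw [h, integral_indicator Metric.isClosed_closedBall.measurableSet, setIntegral_const,
    smul_eq_mul, mul_inv_cancel₀ hpos.ne']

/-- The operator of averaging over balls of radius `ε`. -/
noncomputable abbrev averageOp : C(X, ℝ) →L[ℝ] C(X, ℝ) := kernelOp μ (averageKernel μ ε)

theorem averageOp_mem (u : C(X, ℝ)) : averageOp μ ε u ∈ constOnBalls X ε := fun x y h => by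
  simp only [kernelOp_apply]
  refine integral_congr_ae (Eventually.of_forall fun z => ?_)
  simp only [averageKernel_congr μ ε h ((dist_self z).trans_le ε.2.1.le)]

theorem averageOp_mul {f : C(X, ℝ)} (hf : f ∈ constOnBalls X ε) (u : C(X, ℝ)) :
    averageOp μ ε (f * u) = f * averageOp μ ε u := by
  ext x
  rw [kernelOp_apply, ContinuousMap.mul_apply, kernelOp_apply, ← integral_const_mul]
  refine integral_congr_ae (Eventually.of_forall fun y => ?_)
  have h := averageKernel_mul_congr μ ε (f := f) x y (a := f x) fun h => (hf x y h).symm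
  simp only [ContinuousMap.mul_apply]
  rw [← mul_assoc, h]
  ring

variable [μ.IsOpenPosMeasure]

theorem averageOp_one : averageOp μ ε 1 = (1 : C(X, ℝ)) := by
  ext x
  simp only [kernelOp_apply, ContinuousMap.one_apply, mul_one, integral_averageKernel]

theorem averageOp_of_mem {f : C(X, ℝ)} (hf : f ∈ constOnBalls X ε) : averageOp μ ε f = f := by
  have h := averageOp_mul μ ε hf 1
  rwa [averageOp_one, mul_one] at h

theorem norm_sub_averageOp_le {u : C(X, ℝ)} {c : ℝ} (hc : 0 ≤ c)
    (h : ∀ x y, dist x y ≤ ε → |u x - u y| ≤ c) : ‖u - averageOp μ ε u‖ ≤ c := by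
  refine (ContinuousMap.norm_le _ hc).2 fun x => ?_
  have e : (u - averageOp μ ε u) x = ∫ y, averageKernel μ ε (x, y) * (u x - u y) ∂μ := by
    simp only [mul_sub]
    rw [integral_sub (integrable_of_continuous μ (by fun_prop))
      (integrable_of_continuous μ (by fun_prop)), integral_mul_const, integral_averageKernel,
      one_mul]
    rfl
  rw [e]
  refine (norm_integral_le_of_norm_le (g := fun y => averageKernel μ ε (x, y) * c)
    (integrable_of_continuous μ (by fun_prop)) (Eventually.of_forall fun y => ?_)).trans_eq ?_
  · rw [norm_mul, Real.norm_of_nonneg (averageKernel_nonneg μ ε _)]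
    rcases lt_or_ge (ε : ℝ) (dist x y) with hxy | hxy
    · rw [averageKernel_of_lt μ ε hxy, zero_mul, zero_mul]
    · exact mul_le_mul_of_nonneg_left (h x y hxy) (averageKernel_nonneg μ ε _)
  · rw [integral_mul_const, integral_averageKernel, one_mul]

theorem exists_norm_sub_averageOp_le (u : C(X, ℝ)) {c : ℝ} (hc : 0 < c) :
    ∃ δ > 0, ∀ ε : Set.Ioc (0 : ℝ) r₀, (ε : ℝ) < δ → ‖u - averageOp μ ε u‖ ≤ c := by
  obtain ⟨δ, hδ, h⟩ := Metric.uniformContinuous_iff.1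
    (CompactSpace.uniformContinuous_of_continuous u.continuous) c hc
  refine ⟨δ, hδ, fun ε hε => norm_sub_averageOp_le μ ε hc.le fun x y hxy => ?_⟩
  exact (h (hxy.trans_lt hε)).le

variable {k : X → X → ℝ} (hk : IsUltrametricKernel r₀ k)

theorem kernelOp_trunc_mem (u : C(X, ℝ)) : kernelOp μ (hk.trunc ε) u ∈ constOnBalls X ε :=
  fun x y h => by
    simp only [kernelOp_apply]
    refine integral_congr_ae (Eventually.of_forall fun z => ?_)
    simp only [hk.trunc_congr ε h ((dist_self z).trans_le ε.2.1.le)]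

/-- By Fubini and symmetry the averaging moves onto the truncated kernel, which is already constant
on `ε`-balls in its second variable. -/
theorem kernelOp_trunc_averageOp (u : C(X, ℝ)) :
    kernelOp μ (hk.trunc ε) (averageOp μ ε u) = kernelOp μ (hk.trunc ε) u := by
  ext x
  simp only [kernelOp_apply, ← integral_const_mul]
  rw [integral_integral_swap (integrable_of_continuous (μ.prod μ) (by
    simp only [Function.uncurry_def]
    fun_prop))]
  refine integral_congr_ae (Eventually.of_forall fun z => ?_)
  have h : ∀ y, hk.trunc ε (x, y) * (averageKernel μ ε (y, z) * u z)
      = averageKernel μ ε (z, y) * (hk.trunc ε (x, z) * u z) := fun y => by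
    have h1 := averageKernel_mul_congr μ ε (f := fun y => hk.trunc ε (x, y)) z y
      (a := hk.trunc ε (x, z))
      fun h => hk.trunc_congr ε ((dist_self x).trans_le ε.2.1.le) (by rwa [dist_comm])
    rw [averageKernel_symm μ ε y z, ← mul_assoc, ← mul_assoc, ← h1]
    ring
  simp only [h, integral_mul_const, integral_averageKernel, one_mul]

end Average

/-! ### The truncation error. -/

section TruncatedOperators

variable {X : Type*} [MetricSpace X] [CompactSpace X] [IsUltrametricDist X] [MeasurableSpace X]
  [BorelSpace X] (μ : Measure X) [IsFiniteMeasure μ] [μ.IsOpenPosMeasure] {r₀ : ℝ}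
  {k : X → X → ℝ} (hk : IsUltrametricKernel r₀ k) {δ ε : Set.Ioc (0 : ℝ) r₀}

theorem jumpOp_trunc_mem {f : C(X, ℝ)} (hf : f ∈ constOnBalls X ε) :
    jumpOp μ (hk.trunc ε) f ∈ constOnBalls X ε := fun x y h => by
  rw [jumpOp_apply, jumpOp_apply, kernelOp_trunc_mem μ ε hk f x y h,
    kernelOp_trunc_mem μ ε hk 1 x y h, hf x y h]

/-- The additional jumps have length at most `ε` and do not change the value of `f`. -/
theorem jumpOp_trunc_eq (h : δ ≤ ε) {f : C(X, ℝ)} (hf : f ∈ constOnBalls X ε) :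
    jumpOp μ (hk.trunc δ) f = jumpOp μ (hk.trunc ε) f := by
  ext x
  rw [← sub_eq_zero, jumpOp_sub_apply]
  refine integral_eq_zero_of_ae (Eventually.of_forall fun y => ?_)
  rcases lt_or_ge (ε : ℝ) (dist x y) with hxy | hxy
  · simp only [hk.trunc_sub_trunc_of_lt h hxy, zero_mul, Pi.zero_apply]
  · simp only [hf x y hxy, sub_self, mul_zero, Pi.zero_apply]

theorem jumpOp_trunc_le (h : δ ≤ ε) {u : C(X, ℝ)} {x : X}
    (hx : ∀ y, dist x y ≤ ε → u y ≤ u x) :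
    jumpOp μ (hk.trunc δ) u x ≤ jumpOp μ (hk.trunc ε) u x := by
  rw [← sub_nonpos, jumpOp_sub_apply]
  refine integral_nonpos fun y => ?_
  rcases lt_or_ge (ε : ℝ) (dist x y) with hxy | hxy
  · simp only [hk.trunc_sub_trunc_of_lt h hxy, zero_mul, Pi.zero_apply, le_refl]
  · exact mul_nonpos_of_nonneg_of_nonpos (hk.trunc_sub_trunc_nonneg h x y)
      (sub_nonpos.2 (hx y hxy))

/-- Short jumps preserve the mass of each `ε`-ball: the double integrand is antisymmetric, since
jumps of length at most `ε` stay in the ball and have symmetric rates there. -/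
theorem averageOp_jumpOp_sub (h : δ ≤ ε) (u : C(X, ℝ)) (x : X) :
    averageOp μ ε (jumpOp μ (hk.trunc δ) u - jumpOp μ (hk.trunc ε) u) x = 0 := by
  set F : X → X → ℝ := fun z y => averageKernel μ ε (x, z) *
    ((hk.trunc δ (z, y) - hk.trunc ε (z, y)) * (u y - u z)) with hF
  have hanti : ∀ z y, F y z = -F z y := fun z y => by
    simp only [hF, hk.trunc_sub_trunc_symm h y z]
    rcases lt_or_ge (ε : ℝ) (dist z y) with hzy | hzy
    · rw [hk.trunc_sub_trunc_of_lt h hzy]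
      ring
    · rw [averageKernel_congr μ ε ((dist_self x).trans_le ε.2.1.le) (by rwa [dist_comm])]
      ring
  have hint : averageOp μ ε (jumpOp μ (hk.trunc δ) u - jumpOp μ (hk.trunc ε) u) x
      = ∫ z, ∫ y, F z y ∂μ ∂μ := by
    simp only [kernelOp_apply, ContinuousMap.sub_apply, jumpOp_sub_apply, hF, integral_const_mul]
  have hswap : ∫ z, ∫ y, F z y ∂μ ∂μ = ∫ y, ∫ z, F z y ∂μ ∂μ :=
    integral_integral_swap (integrable_of_continuous (μ.prod μ) (by
      simp only [Function.uncurry_def, hF]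
      fun_prop))
  have hneg : ∫ y, ∫ z, F z y ∂μ ∂μ = -∫ z, ∫ y, F z y ∂μ ∂μ := by
    rw [← integral_neg]
    refine integral_congr_ae (Eventually.of_forall fun y => ?_)
    simp only [← integral_neg]
    exact integral_congr_ae (Eventually.of_forall fun z => hanti y z)
  rw [hint]
  linarith

theorem averageOp_jumpOp (h : δ ≤ ε) (u : C(X, ℝ)) :
    averageOp μ ε (jumpOp μ (hk.trunc δ) u) = jumpOp μ (hk.trunc ε) (averageOp μ ε u) := by
  have h1 : averageOp μ ε (jumpOp μ (hk.trunc δ) u) = averageOp μ ε (jumpOp μ (hk.trunc ε) u) := by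
    ext x
    have := averageOp_jumpOp_sub μ hk h u x
    rwa [map_sub, ContinuousMap.sub_apply, sub_eq_zero] at this
  have h2 : ∀ v, jumpOp μ (hk.trunc ε) v
      = kernelOp μ (hk.trunc ε) v - kernelOp μ (hk.trunc ε) 1 * v := fun _ => rfl
  rw [h1, h2, h2, map_sub, averageOp_mul μ ε (kernelOp_trunc_mem μ ε hk 1),
    averageOp_of_mem μ ε (kernelOp_trunc_mem μ ε hk u), kernelOp_trunc_averageOp]

theorem jumpOp_trunc_apply_eq (u : C(X, ℝ)) (x : X) :
    jumpOp μ (hk.trunc ε) u x = jumpOp μ (hk.trunc ε) (averageOp μ ε u) x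
      - kernelOp μ (hk.trunc ε) 1 x * (u x - averageOp μ ε u x) := by
  rw [jumpOp_apply, jumpOp_apply, kernelOp_trunc_averageOp]
  ring

/-- Evaluate at a maximum `z` of `w` on the ball of `x`. The extra short jumps only lower the value
at `z`, while the `ε`-truncation acts on mean-zero `w` as multiplication by minus the total rate,
which is constant on the ball. -/
theorem kernelOp_one_mul_le (h : δ ≤ ε) {w : C(X, ℝ)} (hw : averageOp μ ε w = 0) (x : X) :
    kernelOp μ (hk.trunc ε) 1 x * w x ≤ ‖jumpOp μ (hk.trunc δ) w‖ := by
  obtain ⟨z, hz, hmax⟩ := (isCompact_closedBall x (ε : ℝ)).exists_isMaxOn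
    ⟨x, Metric.mem_closedBall_self ε.2.1.le⟩ w.continuous.continuousOn
  have hxz : dist x z ≤ ε := by rwa [dist_comm]
  have hc : 0 ≤ kernelOp μ (hk.trunc ε) 1 z :=
    kernelOp_nonneg (hk.trunc_nonneg ε) (fun _ => zero_le_one) z
  have h1 : jumpOp μ (hk.trunc δ) w z ≤ jumpOp μ (hk.trunc ε) w z :=
    jumpOp_trunc_le μ hk h fun y hy => hmax (by
      rw [IsUltrametricDist.closedBall_eq_of_mem hz]
      rwa [Metric.mem_closedBall, dist_comm])
  rw [jumpOp_trunc_apply_eq μ hk (ε := ε), hw, map_zero, ContinuousMap.zero_apply, sub_zero, zero_sub] at h1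
  rw [kernelOp_trunc_mem μ ε hk 1 x z hxz]
  calc kernelOp μ (hk.trunc ε) 1 z * w x ≤ kernelOp μ (hk.trunc ε) 1 z * w z :=
        mul_le_mul_of_nonneg_left (hmax (Metric.mem_closedBall_self ε.2.1.le)) hc
    _ ≤ -jumpOp μ (hk.trunc δ) w z := by linarith
    _ ≤ ‖jumpOp μ (hk.trunc δ) w‖ :=
        (neg_le_abs _).trans ((jumpOp μ (hk.trunc δ) w).norm_coe_le_norm z)

/-- The truncation error is controlled by the oscillation of the image at scale `ε`. -/
theorem norm_jumpOp_trunc_sub_le (h : δ ≤ ε) (u : C(X, ℝ)) :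
    ‖jumpOp μ (hk.trunc δ) u - jumpOp μ (hk.trunc ε) u‖
      ≤ 2 * ‖jumpOp μ (hk.trunc δ) u - averageOp μ ε (jumpOp μ (hk.trunc δ) u)‖ := by
  set g := jumpOp μ (hk.trunc δ) u
  set w := u - averageOp μ ε u with hw
  have hEw : averageOp μ ε w = 0 := by
    rw [hw, map_sub, averageOp_of_mem μ ε (averageOp_mem μ ε u), sub_self]
  -- Averaging intertwines the two truncations, so the mean-zero part of `u` is sent to the
  -- mean-zero part of `g`.
  have hAw : jumpOp μ (hk.trunc δ) w = g - averageOp μ ε g := by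
    rw [hw, map_sub, jumpOp_trunc_eq μ hk h (averageOp_mem μ ε u), averageOp_jumpOp μ hk h]
  refine (ContinuousMap.norm_le _ (by positivity)).2 fun x => ?_
  have e : (g - jumpOp μ (hk.trunc ε) u) x
      = (g - averageOp μ ε g) x + kernelOp μ (hk.trunc ε) 1 x * w x := by
    rw [ContinuousMap.sub_apply, ContinuousMap.sub_apply, jumpOp_trunc_apply_eq μ hk (ε := ε),
      averageOp_jumpOp μ hk h, hw, ContinuousMap.sub_apply]
    ring
  have h1 := kernelOp_one_mul_le μ hk h hEw x
  -- The one-sided bound for `-w` supplies the other half of the absolute value.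
  have h2 := kernelOp_one_mul_le μ hk h (w := -w) (by rw [map_neg, hEw, neg_zero]) x
  rw [map_neg, norm_neg, ContinuousMap.neg_apply, mul_neg] at h2
  rw [hAw] at h1 h2
  have h3 : ‖kernelOp μ (hk.trunc ε) 1 x * w x‖ ≤ ‖g - averageOp μ ε g‖ :=
    abs_le.2 ⟨by linarith, h1⟩
  rw [e, two_mul]
  exact (norm_add_le _ _).trans (add_le_add ((g - averageOp μ ε g).norm_coe_le_norm x) h3)

theorem jumpOp_trunc_apply_eq_setIntegral (u : C(X, ℝ)) (x : X) :
    jumpOp μ (hk.trunc ε) u x = ∫ y in {y | (ε : ℝ) < dist x y}, k x y * (u y - u x) ∂μ := by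
  rw [jumpOp_apply_eq_integral, ← integral_indicator
    (measurableSet_lt measurable_const (by fun_prop))]
  refine integral_congr_ae (Eventually.of_forall fun y => ?_)
  rcases lt_or_ge (ε : ℝ) (dist x y) with h | h
  · rw [Set.indicator_of_mem (by simpa using h)]
    simp only [hk.trunc_of_lt ε h]
  · rw [Set.indicator_of_notMem (by simpa using h)]
    simp only [hk.trunc_of_le ε h, zero_mul]

end TruncatedOperators

/-! ### The jump semigroup and the improper integral. -/

section JumpSemigroup

variable {X : Type*} [MetricSpace X] [CompactSpace X] [IsUltrametricDist X] [MeasurableSpace X]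
  [BorelSpace X] (μ : Measure X) [IsFiniteMeasure μ] [μ.IsOpenPosMeasure] {r₀ : ℝ}

/-- A sequence of scales in `(0, r₀]` that decreases to `0`. -/
noncomputable def scale (hr : 0 < r₀) (n : ℕ) : Set.Ioc (0 : ℝ) r₀ :=
  ⟨r₀ / (n + 1), by positivity, div_le_self hr.le (by linarith [n.cast_nonneg (α := ℝ)])⟩

theorem scale_antitone (hr : 0 < r₀) : Antitone (scale hr) := fun m n h =>
  Subtype.coe_le_coe.1 (div_le_div_of_nonneg_left hr.le (by positivity) (by
    have : (m : ℝ) ≤ n := by exact_mod_cast h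
    linarith))

theorem exists_scale_lt (hr : 0 < r₀) {c : ℝ} (hc : 0 < c) : ∃ n, (scale hr n : ℝ) < c := by
  obtain ⟨n, hn⟩ := exists_nat_gt (r₀ / c)
  refine ⟨n, ?_⟩
  have : (0 : ℝ) < n + 1 := by positivity
  change r₀ / (n + 1) < c
  rw [div_lt_iff₀ hc] at hn
  rw [div_lt_iff₀ this]
  nlinarith

variable {k : X → X → ℝ} (hr : 0 < r₀) (hk : IsUltrametricKernel r₀ k)

theorem isExhaustion_jumpOp : IsExhaustion (fun n => jumpOp μ (hk.trunc (scale hr n)))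
    (fun n => constOnBalls X (scale hr n)) where
  mono _ _ h := constOnBalls_antitone (scale_antitone hr h)
  isClosed _ := isClosed_constOnBalls _
  mapsTo _ _ hf := jumpOp_trunc_mem μ hk hf
  agree _ _ h _ hf := jumpOp_trunc_eq μ hk (scale_antitone hr h) hf
  dense := Metric.dense_iff.2 fun u c hc => by
    obtain ⟨δ, hδ, h⟩ := exists_norm_sub_averageOp_le (r₀ := r₀) μ u (half_pos hc)
    obtain ⟨n, hn⟩ := exists_scale_lt hr hδ
    refine ⟨averageOp μ (scale hr n) u, ?_, Set.mem_iUnion.2 ⟨n, averageOp_mem μ _ u⟩⟩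
    rw [Metric.mem_ball, dist_comm, dist_eq_norm]
    exact (h _ hn).trans_lt (half_lt_self hc)
  bound n := ⟨_, norm_jumpOp_add_smul_one_le (hk.trunc_nonneg _)⟩

/-- The graph of the operator with kernel `k` on the functions that are constant on the balls of
some radius. -/
def jumpCore : Set (C(X, ℝ) × C(X, ℝ)) :=
  coreGraph (fun n => jumpOp μ (hk.trunc (scale hr n))) fun n => constOnBalls X (scale hr n)

/-- The semigroup generated by the closure of `jumpCore`. -/
noncomputable def jumpSemigroup (t : ℝ≥0) : C(X, ℝ) →L[ℝ] C(X, ℝ) :=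
  (isExhaustion_jumpOp μ hr hk).limitSemigroup t

theorem isFellerSemigroup_jumpSemigroup : IsFellerSemigroup (jumpSemigroup μ hr hk) := by
  have h := (isExhaustion_jumpOp μ hr hk).isContractionSemigroup_limitSemigroup
  refine ⟨h.map_zero, h.map_add, h.strongly_continuous, fun t f hf => ?_, h.contraction⟩
  let K : Submodule ℝ≥0 C(X, ℝ) :=
    { carrier := {f | 0 ≤ f}
      add_mem' := fun {a b} (ha : 0 ≤ a) (hb : 0 ≤ b) => (add_nonneg ha hb : 0 ≤ a + b)
      zero_mem' := le_refl (0 : C(X, ℝ))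
      smul_mem' := fun c f hf => ContinuousMap.le_def.2 fun x =>
        mul_nonneg c.2 (ContinuousMap.le_def.1 hf x) }
  have hK : IsClosed (K : Set C(X, ℝ)) := by
    have e : (K : Set C(X, ℝ)) = ⋂ x : X, {f : C(X, ℝ) | 0 ≤ f x} := by
      ext f
      rw [Set.mem_iInter]
      exact ContinuousMap.le_def
    rw [e]
    exact isClosed_iInter fun x => isClosed_le continuous_const (by fun_prop)
  exact (isExhaustion_jumpOp μ hr hk).limitSemigroup_apply_mem_cone hK
    (fun n => ⟨_, fun g hg => jumpOp_add_smul_one_nonneg (hk.trunc_nonneg _) hg⟩) hf t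

theorem isGeneratorPair_jumpSemigroup_iff {u g : C(X, ℝ)} :
    IsGeneratorPair (jumpSemigroup μ hr hk) u g ↔ (u, g) ∈ closure (jumpCore μ hr hk) :=
  (isExhaustion_jumpOp μ hr hk).isGeneratorPair_limitSemigroup_iff

theorem eq_jumpSemigroup {S : ℝ≥0 → C(X, ℝ) →L[ℝ] C(X, ℝ)} (hS : IsFellerSemigroup S)
    (hgen : ∀ q ∈ jumpCore μ hr hk, IsGeneratorPair S q.1 q.2) : S = jumpSemigroup μ hr hk :=
  funext fun t => congrFun
    ((isExhaustion_jumpOp μ hr hk).eq_limitSemigroup hS.isContractionSemigroup hgen) t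

/-- For fixed `ε` both sides are continuous in `(u, g)`, so the truncation estimate passes from the
core to its closure. -/
theorem norm_sub_jumpOp_le_of_mem_closure {u g : C(X, ℝ)}
    (hug : (u, g) ∈ closure (jumpCore μ hr hk)) (ε : Set.Ioc (0 : ℝ) r₀) :
    ‖g - jumpOp μ (hk.trunc ε) u‖ ≤ 2 * ‖g - averageOp μ ε g‖ := by
  have hclosed : IsClosed {q : C(X, ℝ) × C(X, ℝ) |
      ‖q.2 - jumpOp μ (hk.trunc ε) q.1‖ ≤ 2 * ‖q.2 - averageOp μ ε q.2‖} :=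
    isClosed_le (continuous_snd.sub ((jumpOp μ (hk.trunc ε)).continuous.comp continuous_fst)).norm
      (continuous_const.mul
        (continuous_snd.sub ((averageOp μ ε).continuous.comp continuous_snd)).norm)
  have hsub : jumpCore μ hr hk ⊆ {q : C(X, ℝ) × C(X, ℝ) |
      ‖q.2 - jumpOp μ (hk.trunc ε) q.1‖ ≤ 2 * ‖q.2 - averageOp μ ε q.2‖} := by
    rintro ⟨v, f⟩ ⟨n, hv, hf⟩
    rw [Set.mem_ofPred_eq]
    dsimp only at hv hf ⊢
    -- The scale must be finer than `ε` and also fine enough to resolve `v`.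
    obtain ⟨m, hm⟩ := exists_scale_lt hr ε.2.1
    have hmn : scale hr (max m n) ≤ ε :=
      (scale_antitone hr (le_max_left m n)).trans (Subtype.coe_le_coe.1 hm.le)
    rw [← hf, ← jumpOp_trunc_eq μ hk (scale_antitone hr (le_max_right m n)) hv]
    exact norm_jumpOp_trunc_sub_le μ hk hmn v
  have h := closure_minimal hsub hclosed hug
  rwa [Set.mem_ofPred_eq] at h

variable (k) in
/-- `g(x)` is the improper integral of `k(x, y) (u(y) - u(x))` with singularity at `y = x`. -/
def IsImproperPair (u g : C(X, ℝ)) : Prop :=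
  ∀ x, Tendsto (fun ε : ℝ => ∫ y in {y | ε < dist x y}, k x y * (u y - u x) ∂μ)
    (𝓝[>] 0) (𝓝 (g x))

/-- For `ε ≤ r₀` the truncated integrals are values of a bounded operator, hence linear in `u`. -/
theorem IsImproperPair.sub (hr : 0 < r₀) (hk : IsUltrametricKernel r₀ k) {u g u' g' : C(X, ℝ)}
    (h : IsImproperPair μ k u g) (h' : IsImproperPair μ k u' g') :
    IsImproperPair μ k (u - u') (g - g') := fun x => by
  refine ((h x).sub (h' x)).congr' ?_
  filter_upwards [Ioc_mem_nhdsGT hr] with ε hε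
  have e := jumpOp_trunc_apply_eq_setIntegral μ hk (ε := ⟨ε, hε⟩)
  rw [← e u x, ← e u' x, ← e (u - u') x, map_sub, ContinuousMap.sub_apply]

/-- Maximum principle: at a global maximum of `u` every truncated integral is nonpositive. -/
theorem IsImproperPair.le_zero (hk : IsUltrametricKernel r₀ k) {u : C(X, ℝ)}
    (h : IsImproperPair μ k u u) (x : X) : u x ≤ 0 := by
  obtain ⟨z, -, hz⟩ := isCompact_univ.exists_isMaxOn ⟨x, Set.mem_univ x⟩ u.continuous.continuousOn
  refine (hz (Set.mem_univ x)).trans (le_of_tendsto (h z) (Eventually.of_forall fun ε => ?_))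
  exact integral_nonpos fun y =>
    mul_nonpos_of_nonneg_of_nonpos (hk.nonneg z y) (sub_nonpos.2 (hz (Set.mem_univ y)))

theorem IsImproperPair.eq_zero (hr : 0 < r₀) (hk : IsUltrametricKernel r₀ k) {u : C(X, ℝ)}
    (h : IsImproperPair μ k u u) : u = 0 := by
  have h0 : IsImproperPair μ k 0 0 := fun x => by simp
  have hneg := h0.sub μ hr hk h
  rw [zero_sub] at hneg
  ext x
  have h1 := h.le_zero μ hk x
  have h2 := hneg.le_zero μ hk x
  rw [ContinuousMap.neg_apply] at h2
  exact le_antisymm h1 (by simpa using h2)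

theorem isImproperPair_of_mem_closure {u g : C(X, ℝ)}
    (hug : (u, g) ∈ closure (jumpCore μ hr hk)) : IsImproperPair μ k u g := fun x => by
  refine Metric.tendsto_nhds.2 fun c hc => ?_
  obtain ⟨δ, hδ, h⟩ := exists_norm_sub_averageOp_le (r₀ := r₀) μ g
    (by positivity : (0 : ℝ) < c / 4)
  filter_upwards [Ioc_mem_nhdsGT hr, Ioo_mem_nhdsGT hδ] with ε hε hεδ
  rw [← jumpOp_trunc_apply_eq_setIntegral μ hk (ε := ⟨ε, hε⟩) u x, dist_comm]
  have h1 := norm_sub_jumpOp_le_of_mem_closure μ hr hk hug ⟨ε, hε⟩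
  have h2 := h ⟨ε, hε⟩ hεδ.2
  have h3 := (g - jumpOp μ (hk.trunc ⟨ε, hε⟩) u).norm_coe_le_norm x
  rw [ContinuousMap.sub_apply, ← dist_eq_norm] at h3
  linarith

/-- Solve `u' - g' = u - g` in the closure; the difference of the two pairs is an improper pair `(w,
w)`, which vanishes by the maximum principle. -/
theorem isImproperPair_iff_mem_closure {u g : C(X, ℝ)} :
    IsImproperPair μ k u g ↔ (u, g) ∈ closure (jumpCore μ hr hk) := by
  refine ⟨fun h => ?_, isImproperPair_of_mem_closure μ hr hk⟩
  obtain ⟨⟨u', g'⟩, hq, hsub⟩ := (isExhaustion_jumpOp μ hr hk).exists_mem_closure_sub_eq (u - g)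
  have hd := h.sub μ hr hk (isImproperPair_of_mem_closure μ hr hk hq)
  have e : g - g' = u - u' := by
    dsimp only at hsub
    rw [sub_eq_sub_iff_add_eq_add] at hsub ⊢
    rw [add_comm g, hsub]
  rw [e] at hd
  have hu : u = u' := sub_eq_zero.1 (hd.eq_zero μ hr hk)
  rw [hu, sub_self, sub_eq_zero] at e
  rw [hu, e]
  exact hq

theorem isImproperPair_of_integrable {u g : C(X, ℝ)}
    (hint : ∀ x, Integrable (fun y => k x y * (u y - u x)) μ)
    (hg : ∀ x, g x = ∫ y, k x y * (u y - u x) ∂μ) : IsImproperPair μ k u g := fun x => by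
  have hmeas : ∀ ε : ℝ, MeasurableSet {y | ε < dist x y} := fun ε =>
    measurableSet_lt measurable_const (by fun_prop)
  simp only [hg x, ← integral_indicator (hmeas _)]
  refine tendsto_integral_filter_of_dominated_convergence (fun y => ‖k x y * (u y - u x)‖)
    (Eventually.of_forall fun ε => ((hint x).indicator (hmeas ε)).aestronglyMeasurable)
    (Eventually.of_forall fun ε => Eventually.of_forall fun y => norm_indicator_le_norm_self _ _)
    (hint x).norm (Eventually.of_forall fun y => ?_)
  -- On the diagonal the integrand is zero, so its exclusion from every truncation does no harm.
  rcases eq_or_ne x y with rfl | hxy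
  · simp [Set.indicator_apply]
  · refine tendsto_const_nhds.congr' ?_
    filter_upwards [Ioo_mem_nhdsGT (dist_pos.2 hxy)] with ε hε
    rw [Set.indicator_of_mem]
    exact hε.2

theorem integrable_and_integral_eq_of_mem_jumpCore {q : C(X, ℝ) × C(X, ℝ)}
    (hq : q ∈ jumpCore μ hr hk) (x : X) : Integrable (fun y => k x y * (q.1 y - q.1 x)) μ ∧
      ∫ y, k x y * (q.1 y - q.1 x) ∂μ = q.2 x := by
  obtain ⟨n, hu, hg⟩ := hq
  have e : (fun y => k x y * (q.1 y - q.1 x))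
      = fun y => hk.trunc (scale hr n) (x, y) * (q.1 y - q.1 x) := by
    funext y
    rcases lt_or_ge (scale hr n : ℝ) (dist x y) with h | h
    · rw [hk.trunc_of_lt _ h]
    · rw [hu x y h, sub_self, mul_zero, mul_zero]
  rw [e, ← hg, ← jumpOp_apply_eq_integral]
  exact ⟨integrable_of_continuous μ (by fun_prop), rfl⟩

end JumpSemigroup

/-! ### Graphs of generators and nonnegativity of the vertex kernels. -/

theorem mem_graph_generator_iff {E : Type*} [NormedAddCommGroup E] [NormedSpace ℝ E]
    {T : ℝ≥0 → E →L[ℝ] E} {f g : E} : (f, g) ∈ (generator T).graph ↔ IsGeneratorPair T f g := by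
  rw [LinearPMap.mem_graph_iff]
  constructor
  · rintro ⟨y, rfl, rfl⟩
    exact y.2.choose_spec
  · intro h
    exact ⟨⟨f, g, h⟩, rfl, IsGeneratorPair.unique (Exists.choose_spec ⟨g, h⟩) h⟩

theorem graphDist_nonneg {V : Type*} {G : SimpleGraph V} {κ : V → V → ℝ} (hκ : IsWeight G κ)
    (v w : V) : 0 ≤ graphDist G κ v w :=
  Real.iInf_nonneg fun q => List.sum_nonneg fun a ha => by
    obtain ⟨d, -, rfl⟩ := List.mem_map.1 ha
    exact hκ.nonneg _ _

/-- No existence or boundedness is needed: a real `sSup` of an empty or unbounded set is `0`. -/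
theorem subdominant_nonneg {V : Type*} (d : V → V → ℝ) (v w : V) : 0 ≤ subdominant d v w :=
  Real.sSup_nonneg fun _ hr => by
    obtain ⟨ρ, hρ, -, rfl⟩ := hr
    exact hρ.nonneg v w

theorem vertexKernel_nonneg {V : Type*} {G : SimpleGraph V} {κ : V → V → ℝ} (hκ : IsWeight G κ)
    (α : ℝ) (b : Bullet) (v w : V) : 0 ≤ vertexKernel G κ α b v w := by
  cases b
  · simp only [vertexKernel]
    split_ifs
    · exact Real.rpow_nonneg (hκ.nonneg v w) _
    · exact le_rfl
  · exact Real.rpow_nonneg (graphDist_nonneg hκ v w) _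
  · exact Real.rpow_nonneg (subdominant_nonneg _ v w) _

instance instIsUltrametricDistPadicInt (p : ℕ) [Fact p.Prime] : IsUltrametricDist ℤ_[p] :=
  IsUltrametricDist.isUltrametricDist_of_forall_norm_add_le_max_norm PadicInt.nonarchimedean

/-! ### The Parisi operator on the union of the discs. -/

namespace VertexDiscs

variable {p : ℕ} [Fact p.Prime] {V : Type*} (D : VertexDiscs p V)

theorem isOpen_Z : IsOpen D.Z :=
  isOpen_iUnion fun v => IsUltrametricDist.isOpen_closedBall _ (by
    have : (0 : ℝ) < p := by exact_mod_cast (Fact.out : p.Prime).pos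
    positivity)

instance : IsFiniteMeasure D.measure := by
  refine ⟨?_⟩
  have : IsFiniteMeasure (haar p) := by
    unfold haar
    infer_instance
  unfold measure
  rw [(MeasurableEmbedding.subtype_coe D.isOpen_Z.measurableSet).comap_apply]
  exact measure_lt_top _ _

instance : D.measure.IsOpenPosMeasure := by
  have : (haar p).IsOpenPosMeasure := by
    unfold haar
    infer_instance
  exact Measure.IsOpenPosMeasure.comap _ D.isOpen_Z.isOpenEmbedding_subtypeVal

/-- Points at distance at most all disc radii have the same vertex. -/
theorem vertexOf_eq_of_dist_le {x y : D.Z} {r : ℝ} (hr : ∀ v, r ≤ (p : ℝ) ^ (-(D.level v : ℤ)))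
    (h : dist x y ≤ r) : D.vertexOf x = D.vertexOf y := by
  refine (D.vertexOf_eq_iff x _).2 ?_
  have hy := Metric.mem_closedBall.1 (D.mem_disc_vertexOf y)
  exact Metric.mem_closedBall.2 ((dist_triangle_max _ _ _).trans (max_le (h.trans (hr _)) hy))

/-- Moving points by at most `ε ≤ r` keeps their vertices, and keeps their distance when it exceeds
`ε`. -/
theorem isUltrametricKernel_padicKernel {k : V → V → ℝ} (hk : ∀ v w, 0 ≤ k v w) (α : ℝ) {r : ℝ}
    (hr : ∀ v, r ≤ (p : ℝ) ^ (-(D.level v : ℤ))) :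
    IsUltrametricKernel r (D.padicKernel α k) where
  nonneg x y := by
    unfold padicKernel
    split_ifs
    · exact Real.rpow_nonneg (norm_nonneg _) _
    · exact hk _ _
  symm x y h := by
    have e := D.vertexOf_eq_of_dist_le hr h
    rw [padicKernel, padicKernel, if_pos e, if_pos e.symm, norm_sub_rev]
  congr ε _ hεr x x' y y' h hx hy := by
    have ex := D.vertexOf_eq_of_dist_le hr (hx.trans hεr)
    have ey := D.vertexOf_eq_of_dist_le hr (hy.trans hεr)
    have hd : dist x y = dist x' y' := by
      refine le_antisymm ?_ ?_
      · have h' := lt_dist_of_lt_dist hx hy h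
        refine (dist_triangle_max x x' y).trans (max_le (hx.trans h'.le) ?_)
        refine (dist_triangle_max x' y' y).trans (max_le le_rfl ?_)
        rw [dist_comm]
        exact hy.trans h'.le
      · refine (dist_triangle_max x' x y').trans (max_le ?_ ?_)
        · rw [dist_comm]
          exact hx.trans h.le
        · exact (dist_triangle_max x y y').trans (max_le le_rfl (hy.trans h.le))
    rw [Subtype.dist_eq, Subtype.dist_eq, dist_eq_norm, dist_eq_norm] at hd
    rw [padicKernel, padicKernel, ex, ey, hd]

theorem exists_pos_le_radius [Finite V] :
    ∃ r : ℝ, 0 < r ∧ ∀ v, r ≤ (p : ℝ) ^ (-(D.level v : ℤ)) := by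
  obtain ⟨N, hN⟩ := (Set.finite_range D.level).bddAbove
  have hp : (1 : ℝ) < p := by exact_mod_cast (Fact.out : p.Prime).one_lt
  refine ⟨(p : ℝ) ^ (-(N : ℤ)), by positivity, fun v => zpow_le_zpow_right₀ hp.le ?_⟩
  have := hN (Set.mem_range_self v)
  lia

variable {D} [Finite V] {k : D.Z → D.Z → ℝ} {r : ℝ}

theorem mem_graph_parisiOperator_iff {u g : C(D.Z, ℝ)} : (u, g) ∈ (D.parisiOperator k).graph ↔
    (∀ x, Integrable (fun y => k x y * (u y - u x)) D.measure) ∧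
      ∀ x, g x = ∫ y, k x y * (u y - u x) ∂D.measure := by
  rw [LinearPMap.mem_graph_iff]
  constructor
  · rintro ⟨y, rfl, rfl⟩
    exact ⟨y.2.1, fun x => rfl⟩
  · rintro ⟨h1, h2⟩
    refine ⟨⟨u, h1, ?_⟩, rfl, ?_⟩
    · simp only [← h2]
      exact g.continuous
    · ext x
      exact (h2 x).symm

theorem isImproperValue_iff {u g : C(D.Z, ℝ)} :
    D.IsImproperValue k u g ↔ IsImproperPair D.measure k u g := by
  simp only [IsImproperValue, IsImproperPair, Subtype.dist_eq, dist_eq_norm]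

/-- A sandwich: the graph contains the core and, by dominated convergence, is contained in the
improper integral, which is the closure of the core. -/
theorem closure_graph_parisiOperator (hr : 0 < r) (hk : IsUltrametricKernel r k) :
    closure ((D.parisiOperator k).graph : Set (C(D.Z, ℝ) × C(D.Z, ℝ)))
      = closure (jumpCore D.measure hr hk) := by
  refine subset_antisymm (closure_minimal ?_ isClosed_closure) (closure_mono ?_)
  · rintro ⟨u, g⟩ hug
    obtain ⟨h1, h2⟩ := mem_graph_parisiOperator_iff.1 hug
    exact (isImproperPair_iff_mem_closure _ hr hk).1 (isImproperPair_of_integrable _ h1 h2)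
  · intro q hq
    have h := integrable_and_integral_eq_of_mem_jumpCore D.measure hr hk hq
    exact mem_graph_parisiOperator_iff.2 ⟨fun x => (h x).1, fun x => (h x).2.symm⟩

theorem graph_generator_jumpSemigroup (hr : 0 < r) (hk : IsUltrametricKernel r k) :
    (D.parisiOperator k).graph.topologicalClosure
      = (generator (jumpSemigroup D.measure hr hk)).graph := by
  ext ⟨u, g⟩
  rw [mem_graph_generator_iff, isGeneratorPair_jumpSemigroup_iff,
    ← closure_graph_parisiOperator hr hk]
  rfl

theorem isClosable_parisiOperator (hr : 0 < r) (hk : IsUltrametricKernel r k) :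
    (D.parisiOperator k).IsClosable :=
  ⟨_, graph_generator_jumpSemigroup hr hk⟩

theorem closure_parisiOperator (hr : 0 < r) (hk : IsUltrametricKernel r k) :
    generator (jumpSemigroup D.measure hr hk) = (D.parisiOperator k).closure :=
  LinearPMap.eq_of_eq_graph ((graph_generator_jumpSemigroup hr hk).symm.trans
    (isClosable_parisiOperator hr hk).graph_closure_eq_closure_graph)

theorem mem_graph_closure_parisiOperator_iff (hr : 0 < r) (hk : IsUltrametricKernel r k)
    {u g : C(D.Z, ℝ)} :
    (u, g) ∈ (D.parisiOperator k).closure.graph ↔ D.IsImproperValue k u g := by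
  rw [← closure_parisiOperator hr hk, mem_graph_generator_iff, isGeneratorPair_jumpSemigroup_iff,
    isImproperValue_iff, isImproperPair_iff_mem_closure]

theorem existsUnique_fellerSemigroup (hr : 0 < r) (hk : IsUltrametricKernel r k) :
    ∃! T : ℝ≥0 → C(D.Z, ℝ) →L[ℝ] C(D.Z, ℝ),
      IsFellerSemigroup T ∧ generator T = (D.parisiOperator k).closure := by
  refine ⟨jumpSemigroup D.measure hr hk,
    ⟨isFellerSemigroup_jumpSemigroup _ hr hk, closure_parisiOperator hr hk⟩, fun S hS => ?_⟩
  -- Equality of generators is used only on the core.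
  refine eq_jumpSemigroup _ hr hk hS.1 fun q hq => ?_
  rw [← mem_graph_generator_iff, hS.2, ← closure_parisiOperator hr hk, mem_graph_generator_iff,
    isGeneratorPair_jumpSemigroup_iff]
  exact subset_closure hq

end VertexDiscs

end PadicGraph

theorem proposition3p2 (p : ℕ) [Fact p.Prime] {V : Type*} [Finite V]
    (G : SimpleGraph V) (hG : G.Connected) (κ : V → V → ℝ) (hκ : PadicGraph.IsWeight G κ)
    (α : ℝ) (hα : 1 ≤ α) (D : PadicGraph.VertexDiscs p V) (b : PadicGraph.Bullet) :
    (PadicGraph.hOperator G κ α D b).IsClosable ∧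
    (∀ u g : C(D.Z, ℝ), (u, g) ∈ (PadicGraph.hOperator G κ α D b).closure.graph ↔
      D.IsImproperValue (D.padicKernel α (PadicGraph.vertexKernel G κ α b)) u g) ∧
    ∃! T : ℝ≥0 → C(D.Z, ℝ) →L[ℝ] C(D.Z, ℝ),
      PadicGraph.IsFellerSemigroup T ∧
      PadicGraph.generator T = (PadicGraph.hOperator G κ α D b).closure := by
  obtain ⟨r, hr, hle⟩ := D.exists_pos_le_radius
  have hk := D.isUltrametricKernel_padicKernel (PadicGraph.vertexKernel_nonneg hκ α b) α hle
  exact ⟨PadicGraph.VertexDiscs.isClosable_parisiOperator hr hk,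
    fun _ _ => PadicGraph.VertexDiscs.mem_graph_closure_parisiOperator_iff hr hk,
    PadicGraph.VertexDiscs.existsUnique_fellerSemigroup hr hk⟩
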